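/- Let $k$ be a field of characteristic zero, $K$ a commutative unital $k$-algebra, $V$ a $K$-module, and $V_+\subseteq V$ a $k$-subspace. For $k$-subspaces $A,B$ of $V$ write $A<B$ if $(A+B)/B$ is finite dimensional, and put $$E=\{\varphi\in\mathrm{End}_k(V):\varphi(V_+)<V_+\},\quad E_1=\{\varphi:\varphi(V)<V_+\},\quad E_2=\{\varphi:\varphi(V_+)<0\},\quad E_0=E_1\cap E_2 .$$ Assume that $fV_+<V_+$ for all $f\in K$, and denote the image of $f\in K$ in $E$ again by $f$. An endomorphism $\varphi$ of a vector space $W$ over a field $F$ is finite potent if $\varphi^nW$ is finite dimensional for some $n$; then its trace $\mathrm{tr}_W(\varphi)$ and determinant $\mathrm{Det}^F_W(1+\varphi)$ are the ordinary trace of $\varphi$ and the ordinary determinant of $1+\varphi$ on $\varphi^nW$. Elements of $E_0$ are finite potent. For $m\ge1$ and an element $a$ of a $k$-algebra let $\exp_{z^m}(a)=\sum_{j\ge0}z^{mj}a^j/j!$. For $\varphi\in E_0$ this series defines a $k((z))$-linear automorphism of $V_z=k((z))\otimes_kV$. A power series $u\in\mathrm{End}_k(V)[[z]]$ is said to have determinant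 $d\in k((z))$ if $u$ is a ($z$-adically convergent) infinite product $\prod_{i\ge1}\exp_{z^i}(\varphi_i)$ with all $\varphi_i\in E_0$ and if for all large $N$ the automorphism $\prod_{i=1}^N\exp_{z^i}(\varphi_i)$ of $V_z$, which differs from the identity by a finite potent endomorphism, has determinant $d$ over $k((z))$; one then writes $\mathrm{Det}^{k((z))}_{V_z}(u)=d$. Call $(f_1,g_1)$ admissible for $f,g\in K$ if $f_1,g_1\in E$, $f\equiv f_1$ and $g\equiv g_1 \pmod{E_2}$, and $f_1\in E_1$ or $g_1\in E_1$. Then every pair $(f,g)\in K\times K$ has an admissible pair, and the following hold. 1. For $f,g\in K$ and $(f_1,g_1)$ admissible for them, the determinant $$c_{V_+}(f,g):=\mathrm{Det}^{k((z))}_{V_z}\bigl(\exp_z(f_1)\exp_z(g_1)\exp_z(-(f_1+g_1))\bigr)$$ exists, is unique, lies in $k((z))^\times$, and does not depend on the choice of $(f_1,g_1)$. 2. $c_{V_+}\colon K\times K\to k((z))^\times$ is a $2$-cocycle of the additive group $K$ with values in $k((z))^\times$ (trivial action): for all $f,g,h\in K$, $$c_{V_+}(f,g)\,c_{V_+}(f+g,h)=c_{V_+}(g,h)\,c_{V_+}(f,g+h).$$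 3. Consequently there is a central extension of groups $1\to k((z))^\times\to\widetilde K_{V_+}\to K\to1$ with a set-theoretic section $s$ such that $s(f)s(g)=c_{V_+}(f,g)\,s(f+g)$ for all $f,g\in K$. 4. For $f,g\in K$ and every admissible $(f_1,g_1)$ one has $[f_1,g_1]\in E_0$ and $c_{V_+}(f,g)=\exp_{z^2}\bigl(\tfrac12\mathrm{tr}_V[f_1,g_1]\bigr)$. -/

import Mathlib

universe u v w

open scoped TensorProduct

noncomputable section

namespace TateCocycle

/-! ### Finite potent endomorphisms, their trace and their determinant -/

section FinitePotent

variable {F M : Type*} [Field F] [AddCommGroup M] [Module F M]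

/-- `φ` is finite potent: `φ ^ n M` is finite dimensional for some `n`. -/
def IsFinitePotent (φ : Module.End F M) : Prop :=
  ∃ n : ℕ, FiniteDimensional F (LinearMap.range (φ ^ n))

/-- The subspace `φ ^ n M`, for the least `n` for which it is finite dimensional. -/
def core (φ : Module.End F M) : Submodule F M :=
  LinearMap.range (φ ^ sInf {n : ℕ | FiniteDimensional F (LinearMap.range (φ ^ n))})

theorem map_core (φ : Module.End F M) : ∀ x ∈ core φ, φ x ∈ core φ := by
  rintro x ⟨y, rfl⟩
  refine ⟨φ y, ?_⟩
  rw [← Module.End.mul_apply, ← Module.End.mul_apply, ← pow_succ, ← pow_succ']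

/-- Tate's trace of a finite potent endomorphism: the ordinary trace on the finite-dimensional
`φ`-invariant subspace `φ ^ n M`. -/
def tateTrace (φ : Module.End F M) : F :=
  LinearMap.trace F (core φ) (φ.restrict (map_core φ))

/-- The determinant of `1 + φ` for `φ` finite potent: the ordinary determinant of `1 + φ` on the
finite-dimensional `φ`-invariant subspace `φ ^ n M`. -/
def detOneAdd (φ : Module.End F M) : F :=
  LinearMap.det (1 + φ.restrict (map_core φ))

end FinitePotent

/-! ### Tate's algebra `E` and the ideals `E₀`, `E₁`, `E₂` -/

section Tate

variable {k V : Type*} [Field k] [AddCommGroup V] [Module k V]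

/-- `A < B` in Tate's sense: `(A + B) / B` is finite dimensional. -/
def TateLT (A B : Submodule k V) : Prop :=
  FiniteDimensional k ((A ⊔ B).map B.mkQ)

/-- `φ(V₊) < V₊`. -/
def E (Vp : Submodule k V) : Set (Module.End k V) :=
  {φ | TateLT (Vp.map φ) Vp}

/-- `φ(V) < V₊`. -/
def E₁ (Vp : Submodule k V) : Set (Module.End k V) :=
  {φ | TateLT (LinearMap.range φ) Vp}

/-- `φ(V₊) < (0)`. -/
def E₂ (Vp : Submodule k V) : Set (Module.End k V) :=
  {φ | TateLT (Vp.map φ) ⊥}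

/-- `φ(V) < V₊` and `φ(V₊) < (0)`. -/
def E₀ (Vp : Submodule k V) : Set (Module.End k V) :=
  {φ | TateLT (LinearMap.range φ) Vp ∧ TateLT (Vp.map φ) ⊥}

end Tate

/-! ### Exponentials -/

/-- The formal exponential `exp_{z^m}(a) = ∑ j, z^(m j) a^j / j!` (for `m ≥ 1`), a power series
with coefficients in the (possibly noncommutative) `k`-algebra `A`. -/
def zexp (k : Type*) {A : Type*} [Field k] [Ring A] [Algebra k A] (m : ℕ) (a : A) :
    PowerSeries A :=
  PowerSeries.mk fun n => if m ∣ n then ((n / m).factorial : k)⁻¹ • a ^ (n / m) else 0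

/-- The ordered product `a 0 * a 1 * ⋯ * a (n - 1)`. -/
def orderedProd {M : Type*} [Monoid M] (a : ℕ → M) (n : ℕ) : M :=
  ((List.range n).map a).prod

section Operators

/-- Multiplication by a scalar of `k` (coefficientwise) commutes with multiplication in `k((z))`;
this gives `k((z)) ⊗ V` its structure of a `k((z))`-vector space. -/
instance laurentSMulCommClass {k : Type*} [Field k] :
    SMulCommClass k (LaurentSeries k) (LaurentSeries k) :=
  @Algebra.to_smulCommClass k (LaurentSeries k) _ _ HahnSeries.instAlgebra

variable {k V : Type*} [Field k] [AddCommGroup V] [Module k V]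

/-- The coefficient of `z ^ n` of an element of `V_z = k((z)) ⊗ V`. -/
def zcoeff (n : ℤ) : (LaurentSeries k ⊗[k] V) →ₗ[k] V :=
  (TensorProduct.lid k V).toLinearMap ∘ₗ
    LinearMap.rTensor V (HahnSeries.coeff.linearMap (R := k) n)

/-- The `k((z))`-linear operator `T` on `V_z` is given by the power series `u = ∑ zⁿ uₙ` with
coefficients in `End_k(V)`, i.e. `T v = ∑ zⁿ uₙ(v)` for `v ∈ V`. -/
def IsGivenBy (T : Module.End (LaurentSeries k) (LaurentSeries k ⊗[k] V))
    (u : PowerSeries (Module.End k V)) : Prop :=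
  ∀ v : V, (∀ n : ℕ, zcoeff (n : ℤ) (T (1 ⊗ₜ[k] v)) = PowerSeries.coeff n u v) ∧
    ∀ n : ℤ, n < 0 → zcoeff n (T (1 ⊗ₜ[k] v)) = 0

/-- `HasDet Vp u d`: the power series `u` over `End_k(V)` is an infinite product
`∏_{i ≥ 1} exp_{z^i}(φ_i)` with `φ_i ∈ E₀` (the partial products converge `z`-adically to `u`), and
the determinants over `k((z))` of the finite products `exp_z(φ_1) ⋯ exp_{z^N}(φ_N)`, which are
operators on `V_z` that differ from the identity by a finite potent one, are equal to `d` for all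
large `N`. This `d` is the determinant of `u`. The index is shifted: `φ i` is the element that is
usually called `φ_{i+1}`. -/
def HasDet (Vp : Submodule k V) (u : PowerSeries (Module.End k V)) (d : LaurentSeries k) : Prop :=
  ∃ (φ : ℕ → Module.End k V)
    (T : ℕ → Module.End (LaurentSeries k) (LaurentSeries k ⊗[k] V)),
    (∀ i, φ i ∈ E₀ Vp) ∧
    (∀ n : ℕ, ∀ᶠ N in Filter.atTop, PowerSeries.coeff n
      (orderedProd (fun i => zexp k (i + 1) (φ i)) N) = PowerSeries.coeff n u) ∧
    (∀ i, IsGivenBy (T i) (zexp k (i + 1) (φ i))) ∧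
    (∀ᶠ N in Filter.atTop,
      IsFinitePotent (orderedProd T N - 1) ∧ detOneAdd (orderedProd T N - 1) = d)

/-- `exp_z(f₁) exp_z(g₁) exp_z(-(f₁ + g₁))`, a power series in `z` over `End_k(V)`. -/
def expProd (f₁ g₁ : Module.End k V) : PowerSeries (Module.End k V) :=
  zexp k 1 f₁ * zexp k 1 g₁ * zexp k 1 (-(f₁ + g₁))

/-- For endomorphisms `f`, `g` in `E`: the pair `f₁, g₁ ∈ E` satisfies `f ≡ f₁` and `g ≡ g₁`
modulo `E₂`, and `f₁ ∈ E₁` or `g₁ ∈ E₁`. -/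
def Admissible (Vp : Submodule k V) (f g f₁ g₁ : Module.End k V) : Prop :=
  f₁ ∈ E Vp ∧ g₁ ∈ E Vp ∧ f - f₁ ∈ E₂ Vp ∧ g - g₁ ∈ E₂ Vp ∧ (f₁ ∈ E₁ Vp ∨ g₁ ∈ E₁ Vp)

end Operators

end TateCocycle

end

noncomputable section

namespace TateCocycle

/-! ### Invariance of trace and determinant for finite potent maps -/

section FinitePotent

variable {F M N : Type*} [Field F] [AddCommGroup M] [Module F M] [AddCommGroup N] [Module F N]

/-! The trace of the logarithmic derivative determines the determinant. If `u` is a product of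
factors `exp_{z^i}(φ_i)` with all `φ_i` in `E₀`, then `u⁻¹ · z du/dz` has coefficients in `E₀`, and
its trace is the sum of the `i z^i tr φ_i`: passing a factor to the other side is a conjugation,
which Tate's trace does not see. Hence `u` alone fixes every `tr φ_i`, by division by `i` in
characteristic zero. On the other side, `Det exp_{z^i}(φ_i) = exp_{z^i}(tr φ_i)` by Jacobi's
formula, and determinants of such factors multiply. So the determinant does not depend on the
expansion.

For `u = e^{zf₁} e^{zg₁} e^{-z(f₁+g₁)}` the logarithmic derivative is conjugate to `z (e^{-zg₁} f₁
e^{zg₁} - f₁)`. The derivative of the bracket is a conjugate of `[f₁, g₁]`, so the trace is just `z²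
tr [f₁, g₁]`. Only `φ_2` has a possibly nonzero trace, namely half of `tr [f₁, g₁]`
(`trace_of_expansion`, `hasDet_expProd_iff`). The same computation puts the nonconstant coefficients
of `u` in `E₀`, so an expansion can be built degree by degree (`exists_orderedProd_expansion`).

It remains to see that `tr [f₁, g₁]` depends only on `f` and `g`. A commutator of an element of `E₁`
with one of `E₂` has trace zero, so an admissible pair can be moved to `(π f, π g)` with `π` a
projection onto `V₊` (`tateTrace_commutator_eq`). The resulting form is biadditive, and the
exponential of a biadditive form is a normalised 2-cocycle. -/

theorem det_one_add_comp_comm [FiniteDimensional F M] [FiniteDimensional F N]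
    (a : M →ₗ[F] N) (b : N →ₗ[F] M) :
    LinearMap.det (1 + b ∘ₗ a) = LinearMap.det (1 + a ∘ₗ b) := by
  classical
  let bM := Module.finBasis F M
  let bN := Module.finBasis F N
  rw [← LinearMap.det_toMatrix bM, ← LinearMap.det_toMatrix bN, map_add, map_add,
    LinearMap.toMatrix_comp bM bN bM, LinearMap.toMatrix_comp bN bM bN,
    LinearMap.toMatrix_one, LinearMap.toMatrix_one, Matrix.det_one_add_mul_comm]

/-- The trace of `φ` and the determinant of `1 + φ` on an invariant subspace `W`. -/
def restrictInvariants (φ : Module.End F M) (W : Submodule F M) (h : ∀ x ∈ W, φ x ∈ W) : F × F :=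
  (LinearMap.trace F W (φ.restrict h), LinearMap.det (1 + φ.restrict h))

theorem restrictInvariants_comp_comm (a : M →ₗ[F] N) (b : N →ₗ[F] M) (W : Submodule F M)
    (W' : Submodule F N) [FiniteDimensional F W] [FiniteDimensional F W']
    (ha : ∀ x ∈ W, a x ∈ W') (hb : ∀ x ∈ W', b x ∈ W) :
    restrictInvariants (b ∘ₗ a) W (fun x hx => hb _ (ha x hx)) =
      restrictInvariants (a ∘ₗ b) W' (fun x hx => ha _ (hb x hx)) :=
  Prod.ext (LinearMap.trace_comp_comm' (a.restrict ha) (b.restrict hb))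
    (det_one_add_comp_comm (a.restrict ha) (b.restrict hb))

/-- One descends from `W` to `W'` through `W' + φ W`, which needs one power of `φ` less. Each step
is an instance of `tr (ab) = tr (ba)` and `det (1 + ab) = det (1 + ba)`. -/
theorem restrictInvariants_eq_of_le (φ : Module.End F M) (W' : Submodule F M)
    (h' : ∀ x ∈ W', φ x ∈ W') (n : ℕ) :
    ∀ (W : Submodule F M) [FiniteDimensional F W] (h : ∀ x ∈ W, φ x ∈ W), W' ≤ W →
      (∀ x ∈ W, (φ ^ n) x ∈ W') → restrictInvariants φ W h = restrictInvariants φ W' h' := by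
  induction n with
  | zero =>
    intro W _ h hle hn
    obtain rfl : W = W' := le_antisymm (fun x hx => by simpa using hn x hx) hle
    rfl
  | succ n ih =>
    intro W _ h hle hn
    have hle1 : W' ⊔ W.map φ ≤ W := by
      refine sup_le hle ?_
      rintro _ ⟨x, hx, rfl⟩
      exact h x hx
    have h1 : ∀ x ∈ W' ⊔ W.map φ, φ x ∈ W' ⊔ W.map φ := fun x hx =>
      Submodule.mem_sup_right ⟨x, hle1 hx, rfl⟩
    have hW' : ∀ x ∈ W', (φ ^ n) x ∈ W' := fun x hx => by
      have : ∀ m : ℕ, (φ ^ m) x ∈ W' := fun m => by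
        induction m with
        | zero => simpa using hx
        | succ m ihm => rw [pow_succ', Module.End.mul_apply]; exact h' _ ihm
      exact this n
    have : FiniteDimensional F (W' ⊔ W.map φ : Submodule F M) :=
      Submodule.finiteDimensional_of_le hle1
    rw [← ih (W' ⊔ W.map φ) h1 le_sup_left]
    -- Here `a` is `φ` from `W` to `W' + φ W` and `b` is the inclusion back; both composites are
    -- restrictions of `φ`.
    · exact restrictInvariants_comp_comm φ LinearMap.id W (W' ⊔ W.map φ)
        (fun x hx => Submodule.mem_sup_right ⟨x, hx, rfl⟩) (fun x hx => hle1 hx)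
    · intro x hx
      have : (W' ⊔ W.map φ) ≤ W'.comap (φ ^ n) := by
        refine sup_le hW' ?_
        rintro _ ⟨y, hy, rfl⟩
        have := hn y hy
        rwa [pow_succ, Module.End.mul_apply] at this
      exact this hx

/-- Both spaces are compared with their intersection, which absorbs high powers of `φ` from either
one. -/
theorem restrictInvariants_eq (φ : Module.End F M) (W W' : Submodule F M)
    [FiniteDimensional F W] [FiniteDimensional F W']
    (h : ∀ x ∈ W, φ x ∈ W) (h' : ∀ x ∈ W', φ x ∈ W') (n n' : ℕ)
    (hn : LinearMap.range (φ ^ n) ≤ W) (hn' : LinearMap.range (φ ^ n') ≤ W') :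
    restrictInvariants φ W h = restrictInvariants φ W' h' := by
  have hi : ∀ x ∈ W ⊓ W', φ x ∈ W ⊓ W' := fun x hx => ⟨h x hx.1, h' x hx.2⟩
  have pow_mem : ∀ (U : Submodule F M), (∀ x ∈ U, φ x ∈ U) → ∀ x ∈ U, ∀ m : ℕ, (φ ^ m) x ∈ U := by
    intro U hU x hx m
    induction m with
    | zero => simpa using hx
    | succ m ihm => rw [pow_succ', Module.End.mul_apply]; exact hU _ ihm
  rw [restrictInvariants_eq_of_le φ (W ⊓ W') hi n' W h inf_le_left,
    restrictInvariants_eq_of_le φ (W ⊓ W') hi n W' h' inf_le_right]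
  · exact fun x hx => ⟨hn ⟨x, rfl⟩, pow_mem W' h' x hx n⟩
  · exact fun x hx => ⟨pow_mem W h x hx n', hn' ⟨x, rfl⟩⟩

/-- This frees all later computations from the particular space `core φ`: any convenient
finite-dimensional invariant subspace that absorbs a power of `φ` will do. -/
theorem core_invariants (φ : Module.End F M) (W : Submodule F M) [FiniteDimensional F W]
    (h : ∀ x ∈ W, φ x ∈ W) (n : ℕ) (hn : LinearMap.range (φ ^ n) ≤ W) :
    (tateTrace φ, detOneAdd φ) = restrictInvariants φ W h := by
  have hne : {n : ℕ | FiniteDimensional F (LinearMap.range (φ ^ n))}.Nonempty :=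
    ⟨n, Submodule.finiteDimensional_of_le hn⟩
  have : FiniteDimensional F (core φ) := Nat.sInf_mem hne
  exact restrictInvariants_eq φ (core φ) W (map_core φ) h _ n le_rfl hn

theorem tateTrace_eq (φ : Module.End F M) (W : Submodule F M) [FiniteDimensional F W]
    (h : ∀ x ∈ W, φ x ∈ W) (n : ℕ) (hn : LinearMap.range (φ ^ n) ≤ W) :
    tateTrace φ = LinearMap.trace F W (φ.restrict h) :=
  congrArg Prod.fst (core_invariants φ W h n hn)

theorem detOneAdd_eq (φ : Module.End F M) (W : Submodule F M) [FiniteDimensional F W]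
    (h : ∀ x ∈ W, φ x ∈ W) (n : ℕ) (hn : LinearMap.range (φ ^ n) ≤ W) :
    detOneAdd φ = LinearMap.det (1 + φ.restrict h) :=
  congrArg Prod.snd (core_invariants φ W h n hn)

theorem detOneAdd_eq_of_injective [FiniteDimensional F N] (φ : Module.End F M)
    (ι : N →ₗ[F] M) (hι : Function.Injective ι) (ψ : Module.End F N)
    (h : ∀ x, φ (ι x) = ι (ψ x)) (n : ℕ) (hn : LinearMap.range (φ ^ n) ≤ LinearMap.range ι) :
    detOneAdd φ = LinearMap.det (1 + ψ) := by
  have hW : ∀ x ∈ LinearMap.range ι, φ x ∈ LinearMap.range ι := by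
    rintro _ ⟨x, rfl⟩
    exact ⟨ψ x, (h x).symm⟩
  rw [detOneAdd_eq φ (LinearMap.range ι) hW n hn]
  let e := LinearEquiv.ofInjective ι hι
  rw [← LinearMap.det_conj (1 + ψ) e]
  congr 1
  ext x
  obtain ⟨y, rfl⟩ := e.surjective x
  simp [e, h]

theorem isFinitePotent_of_le (φ : Module.End F M) (W : Submodule F M) [FiniteDimensional F W]
    (n : ℕ) (hn : LinearMap.range (φ ^ n) ≤ W) : IsFinitePotent φ :=
  ⟨n, Submodule.finiteDimensional_of_le hn⟩

theorem mul_pow_succ_eq (a b : Module.End F M) (n : ℕ) :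
    (b * a) ^ (n + 1) = b * (a * b) ^ n * a := by
  induction n with
  | zero => simp
  | succ n ih => rw [pow_succ, ih, pow_succ]; simp only [mul_assoc]

/-- If `W` is the range of `(ab)^n`, then `b` maps `W` to `b W` and `a` maps back. The space `b W`
can be used for `ba` because `(ba)^(n+1) = b (ab)^n a`. -/
theorem tateTrace_mul_comm (a b : Module.End F M) (hab : IsFinitePotent (a * b)) :
    tateTrace (a * b) = tateTrace (b * a) := by
  obtain ⟨n, hn⟩ := hab
  set W := LinearMap.range ((a * b) ^ n) with hW
  have h : ∀ x ∈ W, (a * b) x ∈ W := by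
    rintro _ ⟨y, rfl⟩
    exact ⟨(a * b) y, by rw [← Module.End.mul_apply, ← Module.End.mul_apply, ← pow_succ,
      ← pow_succ']⟩
  have hb : ∀ x ∈ W, b x ∈ W.map b := fun x hx => ⟨x, hx, rfl⟩
  have ha : ∀ x ∈ W.map b, a x ∈ W := by
    rintro _ ⟨x, hx, rfl⟩
    exact h x hx
  rw [tateTrace_eq (a * b) W h n le_rfl,
    tateTrace_eq (b * a) (W.map b) (fun x hx => hb _ (ha x hx)) (n + 1)]
  · exact congrArg Prod.fst (restrictInvariants_comp_comm b a W (W.map b) hb ha)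
  · rintro _ ⟨x, rfl⟩
    rw [mul_pow_succ_eq]
    exact ⟨_, ⟨a x, rfl⟩, rfl⟩

end FinitePotent

/-! ### The ideals of Tate's algebra and the linearity of the trace on `E₀` -/

section Ideals

variable {k V : Type*} [Field k] [AddCommGroup V] [Module k V]

/-- The working form of `<`: a linear section of the quotient map lifts the finite-dimensional
quotient to a complement `X`. -/
theorem tateLT_iff {A B : Submodule k V} :
    TateLT A B ↔ ∃ X : Submodule k V, FiniteDimensional k X ∧ A ≤ B ⊔ X := by
  constructor
  · intro h
    obtain ⟨s, hs⟩ := B.mkQ.exists_rightInverse_of_surjective B.range_mkQ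
    have : FiniteDimensional k ((A ⊔ B).map B.mkQ) := h
    refine ⟨((A ⊔ B).map B.mkQ).map s, inferInstance, fun a ha => ?_⟩
    have h1 : a - s (B.mkQ a) ∈ B := by
      have := LinearMap.congr_fun hs (B.mkQ a)
      refine (Submodule.Quotient.mk_eq_zero B).1 ?_
      rw [Submodule.Quotient.mk_sub, sub_eq_zero]
      exact this.symm
    rw [← sub_add_cancel a (s (B.mkQ a))]
    exact Submodule.add_mem_sup h1 ⟨_, ⟨a, Submodule.mem_sup_left ha, rfl⟩, rfl⟩
  · rintro ⟨X, hX, hle⟩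
    refine Submodule.finiteDimensional_of_le (S₂ := X.map B.mkQ) ?_
    refine (Submodule.map_mono (sup_le hle le_sup_left)).trans ?_
    rw [Submodule.map_sup, Submodule.mkQ_map_self, bot_sup_eq]

namespace TateLT

variable {A A' B C : Submodule k V}

theorem of_le (h : A ≤ B) : TateLT A B :=
  tateLT_iff.2 ⟨⊥, inferInstance, h.trans le_sup_left⟩

theorem trans (h : TateLT A B) (h' : TateLT B C) : TateLT A C := by
  obtain ⟨X, hX, h⟩ := tateLT_iff.1 h
  obtain ⟨Y, hY, h'⟩ := tateLT_iff.1 h'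
  refine tateLT_iff.2 ⟨Y ⊔ X, inferInstance, h.trans ?_⟩
  rw [← sup_assoc]
  exact sup_le_sup_right h' X

theorem sup (h : TateLT A C) (h' : TateLT A' C) : TateLT (A ⊔ A') C := by
  obtain ⟨X, hX, h⟩ := tateLT_iff.1 h
  obtain ⟨Y, hY, h'⟩ := tateLT_iff.1 h'
  exact tateLT_iff.2 ⟨X ⊔ Y, inferInstance,
    sup_le (h.trans (sup_le_sup_left le_sup_left C)) (h'.trans (sup_le_sup_left le_sup_right C))⟩

theorem map (h : TateLT A B) (φ : Module.End k V) : TateLT (A.map φ) (B.map φ) := by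
  obtain ⟨X, hX, h⟩ := tateLT_iff.1 h
  exact tateLT_iff.2 ⟨X.map φ, inferInstance, by
    rw [← Submodule.map_sup]; exact Submodule.map_mono h⟩

theorem map_zero (A B : Submodule k V) : TateLT (A.map (0 : Module.End k V)) B :=
  of_le (by rw [Submodule.map_zero]; exact bot_le)

theorem map_add {φ ψ : Module.End k V} (h : TateLT (A.map φ) B) (h' : TateLT (A.map ψ) B) :
    TateLT (A.map (φ + ψ)) B :=
  (of_le (Submodule.map_add_le A φ ψ)).trans (h.sup h')

theorem map_smul {φ : Module.End k V} (h : TateLT (A.map φ) B) (c : k) :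
    TateLT (A.map (c • φ)) B := by
  refine (of_le ?_).trans h
  rintro _ ⟨x, hx, rfl⟩
  exact Submodule.smul_mem _ c ⟨x, hx, rfl⟩

theorem map_mul {φ ψ : Module.End k V} (h : TateLT (A.map ψ) B) (h' : TateLT (B.map φ) C) :
    TateLT (A.map (φ * ψ)) C := by
  have : A.map (φ * ψ) = (A.map ψ).map φ := Submodule.map_comp ψ φ A
  rw [this]
  exact (h.map φ).trans h'

end TateLT

variable (Vp : Submodule k V)

/-- Tate's algebra `E` as a subalgebra of `End_k(V)`. -/
def tateAlgebra : Subalgebra k (Module.End k V) where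
  carrier := E Vp
  mul_mem' ha hb := TateLT.map_mul hb ha
  add_mem' ha hb := TateLT.map_add ha hb
  algebraMap_mem' r := by
    rw [Algebra.algebraMap_eq_smul_one]
    exact TateLT.map_smul (TateLT.of_le (Submodule.map_id Vp).le) r

/-- `E₁` as a subspace. -/
def tateIdealOne : Submodule k (Module.End k V) where
  carrier := {φ | TateLT ((⊤ : Submodule k V).map φ) Vp}
  zero_mem' := TateLT.map_zero _ _
  add_mem' ha hb := TateLT.map_add ha hb
  smul_mem' c _ h := TateLT.map_smul h c

/-- `E₂` as a subspace. -/
def tateIdealTwo : Submodule k (Module.End k V) where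
  carrier := E₂ Vp
  zero_mem' := TateLT.map_zero _ _
  add_mem' ha hb := TateLT.map_add ha hb
  smul_mem' c _ h := TateLT.map_smul h c

/-- `E₀` as a subspace. -/
def tateIdealZero : Submodule k (Module.End k V) := tateIdealOne Vp ⊓ tateIdealTwo Vp

variable {Vp}

theorem mem_tateAlgebra {φ : Module.End k V} : φ ∈ tateAlgebra Vp ↔ φ ∈ E Vp := Iff.rfl

theorem mem_tateIdealOne {φ : Module.End k V} : φ ∈ tateIdealOne Vp ↔ φ ∈ E₁ Vp := by
  change TateLT ((⊤ : Submodule k V).map φ) Vp ↔ TateLT (LinearMap.range φ) Vp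
  rw [LinearMap.range_eq_map]

theorem mem_tateIdealTwo {φ : Module.End k V} : φ ∈ tateIdealTwo Vp ↔ φ ∈ E₂ Vp := Iff.rfl

theorem mem_tateIdealZero {φ : Module.End k V} : φ ∈ tateIdealZero Vp ↔ φ ∈ E₀ Vp :=
  and_congr mem_tateIdealOne Iff.rfl

theorem tateIdealOne_le {φ : Module.End k V} (h : φ ∈ tateIdealOne Vp) : φ ∈ tateAlgebra Vp :=
  (TateLT.of_le (Submodule.map_mono le_top)).trans h

theorem tateIdealTwo_le {φ : Module.End k V} (h : φ ∈ tateIdealTwo Vp) : φ ∈ tateAlgebra Vp :=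
  TateLT.trans h (TateLT.of_le bot_le)

theorem mul_mem_tateIdealOne {φ ψ : Module.End k V} (h : φ ∈ tateAlgebra Vp)
    (h' : ψ ∈ tateIdealOne Vp) : φ * ψ ∈ tateIdealOne Vp :=
  TateLT.map_mul h' h

theorem mul_mem_tateIdealOne' {φ ψ : Module.End k V} (h' : ψ ∈ tateIdealOne Vp) :
    ψ * φ ∈ tateIdealOne Vp :=
  TateLT.map_mul (TateLT.of_le le_top) h'

theorem mul_mem_tateIdealTwo {φ ψ : Module.End k V} (h' : ψ ∈ tateIdealTwo Vp) :
    φ * ψ ∈ tateIdealTwo Vp :=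
  TateLT.map_mul h' (TateLT.of_le (Submodule.map_bot φ).le)

theorem mul_mem_tateIdealTwo' {φ ψ : Module.End k V} (h : φ ∈ tateAlgebra Vp)
    (h' : ψ ∈ tateIdealTwo Vp) : ψ * φ ∈ tateIdealTwo Vp :=
  TateLT.map_mul h h'

theorem mul_mem_tateIdealZero {φ ψ : Module.End k V} (h : φ ∈ tateAlgebra Vp)
    (h' : ψ ∈ tateIdealZero Vp) : φ * ψ ∈ tateIdealZero Vp :=
  ⟨mul_mem_tateIdealOne h h'.1, mul_mem_tateIdealTwo h'.2⟩

theorem mul_mem_tateIdealZero' {φ ψ : Module.End k V} (h : φ ∈ tateAlgebra Vp)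
    (h' : ψ ∈ tateIdealZero Vp) : ψ * φ ∈ tateIdealZero Vp :=
  ⟨mul_mem_tateIdealOne' h'.1, mul_mem_tateIdealTwo' h h'.2⟩

/-- `φ` maps the whole space to `U` and `U` to `W`. -/
def LowersTo (U W : Submodule k V) (φ : Module.End k V) : Prop :=
  (∀ v, φ v ∈ U) ∧ ∀ u ∈ U, φ u ∈ W

namespace LowersTo

variable {U W : Submodule k V} {φ ψ : Module.End k V}

theorem add (h : LowersTo U W φ) (h' : LowersTo U W ψ) : LowersTo U W (φ + ψ) :=
  ⟨fun v => U.add_mem (h.1 v) (h'.1 v), fun u hu => W.add_mem (h.2 u hu) (h'.2 u hu)⟩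

theorem smul (h : LowersTo U W φ) (c : k) : LowersTo U W (c • φ) :=
  ⟨fun v => U.smul_mem c (h.1 v), fun u hu => W.smul_mem c (h.2 u hu)⟩

theorem mul (h : LowersTo U W φ) (h' : LowersTo U W ψ) (hWU : W ≤ U) : LowersTo U W (φ * ψ) :=
  ⟨fun v => h.1 (ψ v), fun u hu => h.2 _ (hWU (h'.2 u hu))⟩

theorem mapsTo (h : LowersTo U W φ) (hWU : W ≤ U) : ∀ x ∈ W, φ x ∈ W :=
  fun x hx => h.2 x (hWU hx)

theorem range_sq_le (h : LowersTo U W φ) : LinearMap.range (φ ^ 2) ≤ W := by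
  rintro _ ⟨x, rfl⟩
  rw [pow_two]
  exact h.2 _ (h.1 x)

end LowersTo

/-- A common flag `W ≤ U` for both maps lets the traces and determinants of `φ`, `ψ`, their sum and
product be computed on the same `W`. Tate's trace is not additive on arbitrary finite potent maps,
so such a device is needed. -/
theorem exists_lowersTo {φ ψ : Module.End k V} (hφ : φ ∈ tateIdealZero Vp)
    (hψ : ψ ∈ tateIdealZero Vp) :
    ∃ U W : Submodule k V, FiniteDimensional k W ∧ W ≤ U ∧ LowersTo U W φ ∧ LowersTo U W ψ := by
  obtain ⟨X, hX, h1⟩ := tateLT_iff.1 (hφ.1.sup hψ.1)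
  obtain ⟨Y, hY, h2⟩ := tateLT_iff.1 (hφ.2.sup hψ.2)
  rw [bot_sup_eq] at h2
  have hV : ∀ v, φ v ∈ Vp ⊔ X ∧ ψ v ∈ Vp ⊔ X := fun v =>
    ⟨h1 (Submodule.mem_sup_left ⟨v, trivial, rfl⟩), h1 (Submodule.mem_sup_right ⟨v, trivial, rfl⟩)⟩
  have hφU : Vp ⊔ X ≤ (Y ⊔ (X.map φ ⊔ X.map ψ)).comap φ := by
    refine sup_le (fun x hx => Submodule.mem_sup_left (h2 (Submodule.mem_sup_left ⟨x, hx, rfl⟩)))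
      (fun x hx => Submodule.mem_sup_right (Submodule.mem_sup_left ⟨x, hx, rfl⟩))
  have hψU : Vp ⊔ X ≤ (Y ⊔ (X.map φ ⊔ X.map ψ)).comap ψ := by
    refine sup_le (fun x hx => Submodule.mem_sup_left (h2 (Submodule.mem_sup_right ⟨x, hx, rfl⟩)))
      (fun x hx => Submodule.mem_sup_right (Submodule.mem_sup_right ⟨x, hx, rfl⟩))
  -- Intersecting with `U = V₊ + X` secures `W ≤ U`, hence the invariance of `W`.
  exact ⟨Vp ⊔ X, (Vp ⊔ X) ⊓ (Y ⊔ (X.map φ ⊔ X.map ψ)),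
    Submodule.finiteDimensional_of_le inf_le_right, inf_le_left,
    ⟨fun v => (hV v).1, fun u hu => ⟨(hV u).1, hφU hu⟩⟩,
    ⟨fun v => (hV v).2, fun u hu => ⟨(hV u).2, hψU hu⟩⟩⟩

theorem isFinitePotent_of_mem {φ : Module.End k V} (hφ : φ ∈ tateIdealZero Vp) :
    IsFinitePotent φ := by
  obtain ⟨U, W, hW, -, h, -⟩ := exists_lowersTo hφ hφ
  exact isFinitePotent_of_le φ W 2 h.range_sq_le

theorem tateTrace_add {φ ψ : Module.End k V} (hφ : φ ∈ tateIdealZero Vp)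
    (hψ : ψ ∈ tateIdealZero Vp) : tateTrace (φ + ψ) = tateTrace φ + tateTrace ψ := by
  obtain ⟨U, W, hW, hWU, h, h'⟩ := exists_lowersTo hφ hψ
  rw [tateTrace_eq φ W (h.mapsTo hWU) 2 h.range_sq_le,
    tateTrace_eq ψ W (h'.mapsTo hWU) 2 h'.range_sq_le,
    tateTrace_eq (φ + ψ) W ((h.add h').mapsTo hWU) 2 (h.add h').range_sq_le, ← map_add]
  rfl

theorem tateTrace_smul {φ : Module.End k V} (hφ : φ ∈ tateIdealZero Vp) (c : k) :
    tateTrace (c • φ) = c • tateTrace φ := by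
  obtain ⟨U, W, hW, hWU, h, -⟩ := exists_lowersTo hφ hφ
  rw [tateTrace_eq φ W (h.mapsTo hWU) 2 h.range_sq_le,
    tateTrace_eq (c • φ) W ((h.smul c).mapsTo hWU) 2 (h.smul c).range_sq_le, ← map_smul]
  rfl

theorem detOneAdd_mul {φ ψ : Module.End k V} (hφ : φ ∈ tateIdealZero Vp)
    (hψ : ψ ∈ tateIdealZero Vp) :
    detOneAdd ((1 + φ) * (1 + ψ) - 1) = detOneAdd φ * detOneAdd ψ := by
  obtain ⟨U, W, hW, hWU, h, h'⟩ := exists_lowersTo hφ hψ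
  have e : (1 + φ) * (1 + ψ) - 1 = φ + ψ + φ * ψ := by noncomm_ring
  have h'' := (h.add h').add (h.mul h' hWU)
  rw [← e] at h''
  rw [detOneAdd_eq φ W (h.mapsTo hWU) 2 h.range_sq_le,
    detOneAdd_eq ψ W (h'.mapsTo hWU) 2 h'.range_sq_le,
    detOneAdd_eq _ W (h''.mapsTo hWU) 2 h''.range_sq_le, ← LinearMap.det_comp]
  congr 1
  ext x
  simp [mul_add, add_mul]
  abel

/-- The values outside `E₀` are arbitrary; the extension only serves to apply linearity without
tracking memberships. -/
theorem exists_traceExtension (Vp : Submodule k V) : ∃ t : Module.End k V →ₗ[k] k,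
    ∀ φ ∈ tateIdealZero Vp, t φ = tateTrace φ := by
  let t₀ : tateIdealZero Vp →ₗ[k] k :=
    { toFun := fun φ => tateTrace (φ : Module.End k V)
      map_add' := fun φ ψ => tateTrace_add φ.2 ψ.2
      map_smul' := fun c φ => tateTrace_smul φ.2 c }
  obtain ⟨t, ht⟩ := t₀.exists_extend
  exact ⟨t, fun φ hφ => LinearMap.congr_fun ht ⟨φ, hφ⟩⟩

theorem tateTrace_mul_comm_of_mem {φ ψ : Module.End k V} (hφ : φ ∈ tateIdealOne Vp)
    (hψ : ψ ∈ tateIdealTwo Vp) : tateTrace (φ * ψ) = tateTrace (ψ * φ) :=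
  tateTrace_mul_comm φ ψ (isFinitePotent_of_mem (Vp := Vp)
    ⟨mul_mem_tateIdealOne' hφ, mul_mem_tateIdealTwo hψ⟩)

end Ideals

/-! ### Traces of commutators of admissible pairs -/

section Commutators

variable {k V : Type*} [Field k] [AddCommGroup V] [Module k V] {Vp : Submodule k V}

/-- Both products `φψ` and `ψφ` already lie in `E₀`, so the trace may be split and the two terms
cancel. -/
theorem commutator_mem_of_one_two {φ ψ : Module.End k V} (hφ : φ ∈ tateIdealOne Vp)
    (hψ : ψ ∈ tateIdealTwo Vp) :
    φ * ψ - ψ * φ ∈ tateIdealZero Vp ∧ tateTrace (φ * ψ - ψ * φ) = 0 := by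
  have h1 : φ * ψ ∈ tateIdealZero Vp := ⟨mul_mem_tateIdealOne' hφ, mul_mem_tateIdealTwo hψ⟩
  have h2 : ψ * φ ∈ tateIdealZero Vp :=
    ⟨mul_mem_tateIdealOne (tateIdealTwo_le hψ) hφ, mul_mem_tateIdealTwo' (tateIdealOne_le hφ) hψ⟩
  obtain ⟨t, ht⟩ := exists_traceExtension Vp
  refine ⟨sub_mem h1 h2, ?_⟩
  rw [← ht _ (sub_mem h1 h2), map_sub, ht _ h1, ht _ h2, tateTrace_mul_comm_of_mem hφ hψ, sub_self]

theorem commutator_mem {f g f₁ g₁ : Module.End k V} (hf : f ∈ E Vp) (hg : g ∈ E Vp)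
    (hfg : f * g = g * f) (h : Admissible Vp f g f₁ g₁) :
    f₁ * g₁ - g₁ * f₁ ∈ tateIdealZero Vp := by
  obtain ⟨hf₁, hg₁, hff, hgg, hor⟩ := h
  rw [← mem_tateAlgebra] at hf hg hf₁ hg₁
  rw [← mem_tateIdealTwo] at hff hgg
  rw [← mem_tateIdealOne, ← mem_tateIdealOne] at hor
  refine ⟨?_, ?_⟩
  · rcases hor with h | h
    · exact sub_mem (mul_mem_tateIdealOne' h) (mul_mem_tateIdealOne hg₁ h)
    · exact sub_mem (mul_mem_tateIdealOne hf₁ h) (mul_mem_tateIdealOne' h)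
  · have e : f₁ * g₁ - g₁ * f₁ =
        ((g - g₁) * f + g₁ * (f - f₁)) - ((f - f₁) * g + f₁ * (g - g₁)) := by
      have : f₁ * g₁ - g₁ * f₁ = (f₁ * g₁ - f * g) - (g₁ * f₁ - g * f) := by rw [hfg]; abel
      rw [this]
      noncomm_ring
    rw [e]
    exact sub_mem (add_mem (mul_mem_tateIdealTwo' hf hgg) (mul_mem_tateIdealTwo hff))
      (add_mem (mul_mem_tateIdealTwo' hg hff) (mul_mem_tateIdealTwo hgg))

/-- The commutators of two admissible pairs sharing a component have the same trace. -/
theorem tateTrace_commutator_congr_right {f g g' : Module.End k V} (hf : f ∈ tateIdealOne Vp)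
    (h : g - g' ∈ tateIdealTwo Vp) (hm : f * g' - g' * f ∈ tateIdealZero Vp) :
    tateTrace (f * g - g * f) = tateTrace (f * g' - g' * f) := by
  obtain ⟨h1, h2⟩ := commutator_mem_of_one_two hf h
  have e : f * g - g * f = (f * (g - g') - (g - g') * f) + (f * g' - g' * f) := by noncomm_ring
  rw [e, tateTrace_add h1 hm, h2, zero_add]

theorem tateTrace_neg {φ : Module.End k V} (hφ : φ ∈ tateIdealZero Vp) :
    tateTrace (-φ) = -tateTrace φ := by
  simpa using tateTrace_smul hφ (-1)

theorem tateTrace_commutator_congr_left {f f' g : Module.End k V} (hg : g ∈ tateIdealOne Vp)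
    (h : f - f' ∈ tateIdealTwo Vp) (hm : f' * g - g * f' ∈ tateIdealZero Vp) :
    tateTrace (f * g - g * f) = tateTrace (f' * g - g * f') := by
  obtain ⟨h1, h2⟩ := commutator_mem_of_one_two hg h
  have e : f * g - g * f = -(g * (f - f') - (f - f') * g) + (f' * g - g * f') := by noncomm_ring
  rw [e, tateTrace_add (neg_mem h1) hm, tateTrace_neg h1, h2, neg_zero, zero_add]

/-- A projection of `V` onto `V₊`. -/
def proj (Vp : Submodule k V) : Module.End k V :=
  Vp.subtype ∘ₗ (Vp.subtype.exists_leftInverse_of_injective Vp.ker_subtype).choose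

theorem proj_apply_mem (v : V) : proj Vp v ∈ Vp := Subtype.property _

theorem proj_apply_of_mem {v : V} (hv : v ∈ Vp) : proj Vp v = v :=
  congrArg Subtype.val (LinearMap.congr_fun
    (Vp.subtype.exists_leftInverse_of_injective Vp.ker_subtype).choose_spec ⟨v, hv⟩)

theorem proj_mul_mem_one (f : Module.End k V) : proj Vp * f ∈ tateIdealOne Vp :=
  TateLT.of_le (by rintro _ ⟨v, -, rfl⟩; exact proj_apply_mem _)

theorem sub_proj_mul_mem_two {f : Module.End k V} (hf : f ∈ E Vp) :
    f - proj Vp * f ∈ tateIdealTwo Vp := by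
  have : f - proj Vp * f = (1 - proj Vp) * f := by noncomm_ring
  rw [this]
  refine TateLT.map_mul hf (TateLT.of_le ?_)
  rintro _ ⟨v, hv, rfl⟩
  simp [proj_apply_of_mem hv]

theorem admissible_proj {f g : Module.End k V} (hf : f ∈ E Vp) (hg : g ∈ E Vp) :
    Admissible Vp f g (proj Vp * f) (proj Vp * g) :=
  ⟨tateIdealOne_le (proj_mul_mem_one f), tateIdealOne_le (proj_mul_mem_one g),
    sub_proj_mul_mem_two hf, sub_proj_mul_mem_two hg, Or.inl (mem_tateIdealOne.1 (proj_mul_mem_one f))⟩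

/-- One component is replaced at a time, and the component held fixed must lie in `E₁`. So the
component not known to be in `E₁` is projected first, after which the other one can be changed. -/
theorem tateTrace_commutator_eq {f g f₁ g₁ : Module.End k V} (hf : f ∈ E Vp) (hg : g ∈ E Vp)
    (hfg : f * g = g * f) (h : Admissible Vp f g f₁ g₁) :
    tateTrace (f₁ * g₁ - g₁ * f₁) =
      tateTrace ((proj Vp * f) * (proj Vp * g) - (proj Vp * g) * (proj Vp * f)) := by
  obtain ⟨hf₁, hg₁, hff, hgg, hor⟩ := h
  have sub_mem_two : ∀ {a a₁ : Module.End k V}, a ∈ E Vp → a - a₁ ∈ E₂ Vp →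
      a₁ - proj Vp * a ∈ tateIdealTwo Vp := fun {a a₁} ha haa => by
    have e : a₁ - proj Vp * a = (a - proj Vp * a) - (a - a₁) := by abel
    rw [e]
    exact sub_mem (sub_proj_mul_mem_two ha) haa
  rcases hor with h | h
  · rw [tateTrace_commutator_congr_right (mem_tateIdealOne.2 h) (sub_mem_two hg hgg)
      (commutator_mem hf hg hfg ⟨hf₁, tateIdealOne_le (proj_mul_mem_one g), hff,
        sub_proj_mul_mem_two hg, Or.inl h⟩)]
    exact tateTrace_commutator_congr_left (proj_mul_mem_one g) (sub_mem_two hf hff)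
      (commutator_mem hf hg hfg (admissible_proj hf hg))
  · rw [tateTrace_commutator_congr_left (mem_tateIdealOne.2 h) (sub_mem_two hf hff)
      (commutator_mem hf hg hfg ⟨tateIdealOne_le (proj_mul_mem_one f), hg₁,
        sub_proj_mul_mem_two hf, hgg, Or.inr h⟩)]
    exact tateTrace_commutator_congr_right (proj_mul_mem_one f) (sub_mem_two hg hgg)
      (commutator_mem hf hg hfg (admissible_proj hf hg))

end Commutators

/-! ### The derivation `z d/dz` -/

section Euler

variable {A : Type*} [Ring A]

/-- The Euler derivation `z d/dz` on power series. -/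
def euler : PowerSeries A →+ PowerSeries A where
  toFun u := PowerSeries.mk fun n => n • PowerSeries.coeff n u
  map_zero' := by ext; simp
  map_add' u v := by ext; simp

theorem coeff_euler (u : PowerSeries A) (n : ℕ) :
    PowerSeries.coeff n (euler u) = n • PowerSeries.coeff n u :=
  PowerSeries.coeff_mk n fun n => n • PowerSeries.coeff n u

theorem euler_mul (u v : PowerSeries A) : euler (u * v) = euler u * v + u * euler v := by
  ext n
  rw [map_add, coeff_euler, PowerSeries.coeff_mul, PowerSeries.coeff_mul, PowerSeries.coeff_mul,
    Finset.smul_sum, ← Finset.sum_add_distrib]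
  refine Finset.sum_congr rfl fun p hp => ?_
  rw [coeff_euler, coeff_euler, ← Finset.HasAntidiagonal.mem_antidiagonal.1 hp, add_smul,
    smul_mul_assoc, mul_smul_comm]

theorem euler_C (a : A) : euler (PowerSeries.C a) = 0 := by
  ext n
  rw [coeff_euler, PowerSeries.coeff_C]
  split_ifs with h <;> simp [h]

theorem coeff_mul_eq_add (u v : PowerSeries A) (n : ℕ) :
    PowerSeries.coeff (n + 1) (u * v) = PowerSeries.coeff 0 u * PowerSeries.coeff (n + 1) v +
      ∑ p ∈ Finset.HasAntidiagonal.antidiagonal n, PowerSeries.coeff (p.1 + 1) u * PowerSeries.coeff p.2 v := by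
  rw [PowerSeries.coeff_mul, Finset.Nat.sum_antidiagonal_succ]

end Euler

/-! ### Formal exponentials as solutions of differential equations -/

section Exponential

variable {k A : Type*} [Field k] [Ring A] [Algebra k A]

variable (k) in
theorem eq_zero_of_nsmul_eq_zero [CharZero k] {n : ℕ} (hn : n ≠ 0) {a : A} (h : n • a = 0) :
    a = 0 := by
  rw [← Nat.cast_smul_eq_nsmul k] at h
  exact (smul_eq_zero_iff_right (Nat.cast_ne_zero.2 hn)).1 h

theorem coeff_zexp (m n : ℕ) (a : A) : PowerSeries.coeff n (zexp k m a) =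
    if m ∣ n then ((n / m).factorial : k)⁻¹ • a ^ (n / m) else 0 :=
  PowerSeries.coeff_mk _ _

theorem coeff_zero_zexp (m : ℕ) (a : A) : PowerSeries.coeff 0 (zexp k m a) = 1 := by
  simp [coeff_zexp]

theorem coeff_zexp_of_lt {m n : ℕ} (hn : n ≠ 0) (h : n < m) (a : A) :
    PowerSeries.coeff n (zexp k m a) = 0 := by
  rw [coeff_zexp, if_neg fun hd => absurd (Nat.le_of_dvd (Nat.pos_of_ne_zero hn) hd) h.not_ge]

theorem coeff_self_zexp {m : ℕ} (hm : m ≠ 0) (a : A) :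
    PowerSeries.coeff m (zexp k m a) = a := by
  rw [coeff_zexp, if_pos dvd_rfl, Nat.div_self (Nat.pos_of_ne_zero hm)]
  simp

theorem commute_C_zexp (m : ℕ) {a b : A} (h : Commute b a) :
    Commute (PowerSeries.C b) (zexp k m a) := by
  ext n
  rw [PowerSeries.coeff_C_mul, PowerSeries.coeff_mul_C, coeff_zexp]
  split_ifs
  · rw [mul_smul_comm, smul_mul_assoc, (h.pow_right _).eq]
  · simp

theorem euler_zexp [CharZero k] {m : ℕ} (hm : m ≠ 0) (a : A) :
    euler (zexp k m a) = PowerSeries.X ^ m * (PowerSeries.C (m • a) * zexp k m a) := by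
  ext n
  rw [coeff_euler, PowerSeries.coeff_X_pow_mul', PowerSeries.coeff_C_mul, coeff_zexp, coeff_zexp]
  by_cases hd : m ∣ n
  · obtain ⟨q, rfl⟩ := hd
    rw [if_pos (dvd_mul_right m q), Nat.mul_div_cancel_left q (Nat.pos_of_ne_zero hm)]
    rcases q with _ | q
    · simp [hm]
    · have e : m * (q + 1) - m = m * q := by rw [mul_add, mul_one, Nat.add_sub_cancel]
      rw [if_pos (Nat.le_mul_of_pos_right m (Nat.succ_pos q)), e, if_pos (dvd_mul_right m q),
        Nat.mul_div_cancel_left q (Nat.pos_of_ne_zero hm), mul_smul_comm, smul_mul_assoc,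
        ← pow_succ', ← Nat.cast_smul_eq_nsmul k, ← Nat.cast_smul_eq_nsmul k, smul_smul, smul_smul]
      congr 1
      have h1 : ((q + 1 : ℕ) : k) ≠ 0 := Nat.cast_ne_zero.2 (Nat.succ_ne_zero q)
      have h2 : (q.factorial : k) ≠ 0 := Nat.cast_ne_zero.2 (Nat.factorial_ne_zero q)
      rw [Nat.factorial_succ, Nat.cast_mul, Nat.cast_mul]
      field_simp
  · rw [if_neg hd, smul_zero]
    split_ifs with h1 h2
    · exact absurd ((Nat.dvd_sub_iff_left h1 dvd_rfl).1 h2) hd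
    · simp
    · rfl

theorem euler_zexp' [CharZero k] {m : ℕ} (hm : m ≠ 0) (a : A) :
    euler (zexp k m a) = zexp k m a * (PowerSeries.X ^ m * PowerSeries.C (m • a)) := by
  rw [euler_zexp hm, ((commute_C_zexp (k := k) m ((Commute.refl a).smul_left m))).eq, ← mul_assoc,
    PowerSeries.X_pow_mul, mul_assoc]

variable (k) in
-- The equation reads `n u_n = b u_{n-m}` for `n ≥ m` and `n u_n = 0` for `n < m`, which determines
-- `u` from its constant term in characteristic zero.
theorem eq_of_euler_eq [CharZero k] {m : ℕ} (hm : m ≠ 0) (b : A) {u v : PowerSeries A}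
    (h0 : PowerSeries.coeff 0 u = PowerSeries.coeff 0 v)
    (hu : euler u = PowerSeries.X ^ m * (PowerSeries.C b * u))
    (hv : euler v = PowerSeries.X ^ m * (PowerSeries.C b * v)) : u = v := by
  ext n
  induction n using Nat.strong_induction_on with
  | _ n ih =>
    rcases eq_or_ne n 0 with rfl | hn
    · exact h0
    · have hu' := congrArg (PowerSeries.coeff n) hu
      have hv' := congrArg (PowerSeries.coeff n) hv
      rw [coeff_euler, PowerSeries.coeff_X_pow_mul', PowerSeries.coeff_C_mul] at hu' hv'
      rw [← sub_eq_zero]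
      apply eq_zero_of_nsmul_eq_zero k hn
      rw [smul_sub, hu', hv']
      split_ifs
      · rw [ih (n - m) (by omega), sub_self]
      · rw [sub_self]

variable (k) in
theorem eq_one_of_euler_eq_zero [CharZero k] {u : PowerSeries A} (h0 : PowerSeries.coeff 0 u = 1)
    (hu : euler u = 0) : u = 1 := by
  refine eq_of_euler_eq k one_ne_zero 0 ?_ ?_ ?_
  · rw [h0, PowerSeries.coeff_zero_one]
  · rw [hu, map_zero, zero_mul, mul_zero]
  · rw [map_zero, zero_mul, mul_zero]
    exact euler_C 1

theorem coeff_zero_mul (u v : PowerSeries A) :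
    PowerSeries.coeff 0 (u * v) = PowerSeries.coeff 0 u * PowerSeries.coeff 0 v := by
  rw [PowerSeries.coeff_mul]
  simp

theorem zexp_neg_mul_zexp [CharZero k] {m : ℕ} (hm : m ≠ 0) (a : A) :
    zexp k m (-a) * zexp k m a = 1 := by
  refine eq_one_of_euler_eq_zero k ?_ ?_
  · rw [coeff_zero_mul, coeff_zero_zexp, coeff_zero_zexp, one_mul]
  · rw [euler_mul, euler_zexp' hm, euler_zexp hm, smul_neg, map_neg]
    noncomm_ring

theorem zexp_mul_zexp_neg [CharZero k] {m : ℕ} (hm : m ≠ 0) (a : A) :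
    zexp k m a * zexp k m (-a) = 1 := by
  simpa using zexp_neg_mul_zexp (k := k) hm (-a)

theorem zexp_zero [CharZero k] {m : ℕ} (hm : m ≠ 0) : zexp k m (0 : A) = 1 := by
  refine eq_one_of_euler_eq_zero k (coeff_zero_zexp _ _) ?_
  rw [euler_zexp hm, smul_zero, map_zero, zero_mul, mul_zero]

theorem zexp_add [CharZero k] {R : Type*} [CommRing R] [Algebra k R] {m : ℕ} (hm : m ≠ 0)
    (a b : R) : zexp k m (a + b) = zexp k m a * zexp k m b := by
  refine eq_of_euler_eq k hm (m • (a + b)) ?_ (euler_zexp hm _) ?_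
  · rw [coeff_zero_mul]
    simp only [coeff_zero_zexp, one_mul]
  · rw [euler_mul, euler_zexp hm, euler_zexp hm, smul_add, map_add]
    ring

end Exponential

/-! ### Ordered products -/

section OrderedProd

variable {M : Type*} [Monoid M]

theorem orderedProd_zero (a : ℕ → M) : orderedProd a 0 = 1 := rfl

theorem orderedProd_succ (a : ℕ → M) (n : ℕ) :
    orderedProd a (n + 1) = orderedProd a n * a n := by
  simp [orderedProd, List.range_succ]

end OrderedProd

/-! ### Logarithmic derivatives and infinite products of exponentials -/

section TraceIdeal

variable {k A : Type*} [Field k] [Ring A] [Algebra k A]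

/-- `I` is a two-sided ideal of the subalgebra `S`, and `t` is a linear form with
`t (a b) = t (b a)` for `a ∈ S` and `b ∈ I`. -/
structure IsTraceIdeal (S : Subalgebra k A) (I : Submodule k A) (t : A →ₗ[k] k) : Prop where
  le : ∀ b ∈ I, b ∈ S
  mul_mem_left : ∀ a ∈ S, ∀ b ∈ I, a * b ∈ I
  mul_mem_right : ∀ a ∈ S, ∀ b ∈ I, b * a ∈ I
  map_mul_comm : ∀ a ∈ S, ∀ b ∈ I, t (a * b) = t (b * a)

/-- All coefficients of the power series lie in the given subspace. -/
def CoeffsIn (P : Submodule k A) (u : PowerSeries A) : Prop :=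
  ∀ n, PowerSeries.coeff n u ∈ P

namespace CoeffsIn

variable {P : Submodule k A} {u v : PowerSeries A}

theorem add (hu : CoeffsIn P u) (hv : CoeffsIn P v) : CoeffsIn P (u + v) :=
  fun n => by rw [map_add]; exact add_mem (hu n) (hv n)

theorem X_pow_mul (m : ℕ) (hu : CoeffsIn P u) : CoeffsIn P (PowerSeries.X ^ m * u) := by
  intro n
  rw [PowerSeries.coeff_X_pow_mul']
  split_ifs
  · exact hu _
  · exact zero_mem _

theorem C {a : A} (ha : a ∈ P) : CoeffsIn P (PowerSeries.C a) := by
  intro n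
  rw [PowerSeries.coeff_C]
  split_ifs
  · exact ha
  · exact zero_mem _

theorem mul {P Q R : Submodule k A} (h : ∀ a ∈ P, ∀ b ∈ Q, a * b ∈ R) (hu : CoeffsIn P u)
    (hv : CoeffsIn Q v) : CoeffsIn R (u * v) := by
  intro n
  rw [PowerSeries.coeff_mul]
  exact sum_mem fun p _ => h _ (hu _) _ (hv _)

theorem zexp {S : Subalgebra k A} (m : ℕ) {a : A} (ha : a ∈ S) :
    CoeffsIn (Subalgebra.toSubmodule S) (zexp k m a) := by
  intro n
  rw [coeff_zexp]
  split_ifs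
  · exact Submodule.smul_mem _ _ (S.pow_mem ha _)
  · exact zero_mem _

end CoeffsIn

variable {S : Subalgebra k A} {I : Submodule k A} {t : A →ₗ[k] k}

namespace IsTraceIdeal

theorem coeff_mul_comm (h : IsTraceIdeal S I t) {u v : PowerSeries A}
    (hu : CoeffsIn (Subalgebra.toSubmodule S) u) (hv : CoeffsIn I v) (n : ℕ) :
    t (PowerSeries.coeff n (u * v)) = t (PowerSeries.coeff n (v * u)) := by
  rw [PowerSeries.coeff_mul, PowerSeries.coeff_mul, map_sum, map_sum,
    ← Finset.Nat.sum_antidiagonal_swap]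
  exact Finset.sum_congr rfl fun p _ => h.map_mul_comm _ (hu _) _ (hv _)

theorem coeffsIn_conj (h : IsTraceIdeal S I t) {u u' v : PowerSeries A}
    (hu : CoeffsIn (Subalgebra.toSubmodule S) u) (hu' : CoeffsIn (Subalgebra.toSubmodule S) u')
    (hv : CoeffsIn I v) : CoeffsIn I (u' * v * u) :=
  .mul (fun b hb a ha => h.mul_mem_right a ha b hb) (.mul h.mul_mem_left hu' hv) hu

theorem coeff_conj (h : IsTraceIdeal S I t) {u u' v : PowerSeries A}
    (hu : CoeffsIn (Subalgebra.toSubmodule S) u) (hu' : CoeffsIn (Subalgebra.toSubmodule S) u')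
    (hv : CoeffsIn I v) (huu : u * u' = 1) (n : ℕ) :
    t (PowerSeries.coeff n (u' * v * u)) = t (PowerSeries.coeff n v) := by
  rw [← h.coeff_mul_comm hu (.mul h.mul_mem_left hu' hv), ← mul_assoc, huu, one_mul]

end IsTraceIdeal

/-- `w` is the logarithmic derivative `u⁻¹ (z du/dz)` of `u`, and has coefficients in `I`. -/
structure IsLogDeriv (I : Submodule k A) (u w : PowerSeries A) : Prop where
  euler_eq : euler u = u * w
  coeffsIn : CoeffsIn I w

/-- In a noncommutative ring the logarithmic derivative of the left factor is conjugated by the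
right factor `u`. By `coeff_conj` this does not change traces, so these add. -/
theorem IsLogDeriv.mul (h : IsTraceIdeal S I t) {u u' v w w' : PowerSeries A}
    (hv : IsLogDeriv I v w) (hu : IsLogDeriv I u w')
    (hu1 : CoeffsIn (Subalgebra.toSubmodule S) u) (hu1' : CoeffsIn (Subalgebra.toSubmodule S) u')
    (huu : u * u' = 1) : IsLogDeriv I (v * u) (u' * w * u + w') := by
  refine ⟨?_, (h.coeffsIn_conj hu1 hu1' hv.coeffsIn).add hu.coeffsIn⟩
  rw [euler_mul, hv.euler_eq, hu.euler_eq]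
  calc v * w * u + v * (u * w') = v * 1 * w * u + v * (u * w') := by rw [mul_one]
    _ = v * (u * u') * w * u + v * (u * w') := by rw [huu]
    _ = _ := by noncomm_ring

theorem isLogDeriv_zexp [CharZero k] {m : ℕ} (hm : m ≠ 0) {a : A} (ha : a ∈ I) :
    IsLogDeriv I (zexp k m a) (PowerSeries.X ^ m * PowerSeries.C (m • a)) :=
  ⟨euler_zexp' hm a, (CoeffsIn.C (nsmul_mem ha m)).X_pow_mul m⟩

/-- Since the constant terms are `1`, the equation `euler u = u w` can be solved for `w`
recursively. Only finitely many coefficients of `u` enter, so a sufficiently long partial product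
can stand for the limit. -/
theorem IsLogDeriv.coeff_eq {u v w w' : PowerSeries A} (hu : IsLogDeriv I u w)
    (hv : IsLogDeriv I v w') (hu0 : PowerSeries.coeff 0 u = 1) (hv0 : PowerSeries.coeff 0 v = 1)
    {n : ℕ} (h : ∀ j ≤ n, PowerSeries.coeff j u = PowerSeries.coeff j v) :
    PowerSeries.coeff n w = PowerSeries.coeff n w' := by
  induction n using Nat.strong_induction_on with
  | _ n ih =>
    have hu' := congrArg (PowerSeries.coeff n) hu.euler_eq
    have hv' := congrArg (PowerSeries.coeff n) hv.euler_eq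
    rw [coeff_euler] at hu' hv'
    rw [h n le_rfl, hv'] at hu'
    rcases n with _ | n
    · rw [coeff_zero_mul, coeff_zero_mul, hu0, hv0, one_mul, one_mul] at hu'
      exact hu'.symm
    · rw [coeff_mul_eq_add, coeff_mul_eq_add, hu0, hv0, one_mul, one_mul] at hu'
      have hsum : ∑ p ∈ Finset.HasAntidiagonal.antidiagonal n,
            PowerSeries.coeff (p.1 + 1) v * PowerSeries.coeff p.2 w' =
          ∑ p ∈ Finset.HasAntidiagonal.antidiagonal n,
            PowerSeries.coeff (p.1 + 1) u * PowerSeries.coeff p.2 w := by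
        refine Finset.sum_congr rfl fun p hp => ?_
        have hp' := Finset.HasAntidiagonal.mem_antidiagonal.1 hp
        rw [h (p.1 + 1) (by omega), ih p.2 (by omega) fun j hj => h j (by omega)]
      rw [hsum] at hu'
      exact (add_right_cancel hu').symm

/-- The trace of the logarithmic derivative of `∏ exp_{z^(i+1)}(φ i)`. -/
theorem exists_isLogDeriv_orderedProd [CharZero k] (h : IsTraceIdeal S I t) (φ : ℕ → A)
    (hφ : ∀ i, φ i ∈ I) (N : ℕ) :
    ∃ w, IsLogDeriv I (orderedProd (fun i => zexp k (i + 1) (φ i)) N) w ∧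
      ∀ n, t (PowerSeries.coeff (n + 1) w) = if n < N then (n + 1) • t (φ n) else 0 := by
  induction N with
  | zero =>
    refine ⟨0, ⟨?_, fun n => by simp⟩, fun n => by simp⟩
    rw [orderedProd_zero, mul_zero]
    exact euler_C 1
  | succ N ih =>
    obtain ⟨w, hw, hwt⟩ := ih
    have hS := h.le _ (hφ N)
    have hu := CoeffsIn.zexp (N + 1) hS
    have hu' := CoeffsIn.zexp (N + 1) (S.neg_mem hS)
    have huu := zexp_mul_zexp_neg (k := k) (Nat.succ_ne_zero N) (φ N)
    rw [orderedProd_succ]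
    refine ⟨_, hw.mul h (isLogDeriv_zexp (Nat.succ_ne_zero N) (hφ N)) hu hu' huu, fun n => ?_⟩
    rw [map_add, map_add, h.coeff_conj hu hu' hw.coeffsIn huu, hwt,
      PowerSeries.coeff_X_pow_mul', PowerSeries.coeff_C]
    rcases lt_trichotomy n N with hn | rfl | hn
    · rw [if_pos hn, if_neg (by omega), if_pos (by omega), map_zero, add_zero]
    · rw [if_neg (lt_irrefl _), if_pos le_rfl, if_pos (Nat.sub_self _), if_pos (Nat.lt_succ_self _),
        map_nsmul, zero_add]
    · rw [if_neg (by omega), if_pos (by omega), if_neg (by omega), if_neg (by omega), map_zero,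
        add_zero]

/-- A power series with constant term `1` and other coefficients in `I` is an infinite product of
exponentials. -/
theorem exists_orderedProd_expansion (h : IsTraceIdeal S I t) (u : PowerSeries A)
    (hu0 : PowerSeries.coeff 0 u = 1) (hu : ∀ n ≠ 0, PowerSeries.coeff n u ∈ I) :
    ∃ φ : ℕ → A, (∀ i, φ i ∈ I) ∧ ∀ N, ∀ n ≤ N,
      PowerSeries.coeff n (orderedProd (fun i => zexp k (i + 1) (φ i)) N) =
        PowerSeries.coeff n u := by
  -- Greedy choice: the exponent `φ N` is the error of the partial product `P N` in degree `N + 1`,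
  -- and the new factor changes nothing in lower degrees.
  let P : ℕ → PowerSeries A := fun N => Nat.rec 1
    (fun N p => p * zexp k (N + 1) (PowerSeries.coeff (N + 1) (u - p))) N
  let φ : ℕ → A := fun N => PowerSeries.coeff (N + 1) (u - P N)
  have hP : ∀ N, P (N + 1) = P N * zexp k (N + 1) (φ N) := fun N => rfl
  have hprod : ∀ N, orderedProd (fun i => zexp k (i + 1) (φ i)) N = P N := by
    intro N
    induction N with
    | zero => rfl
    | succ N ih => rw [orderedProd_succ, ih, hP]
  have hzI : ∀ (m : ℕ) (a : A), a ∈ I → CoeffsIn I (zexp k m a - 1) := by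
    intro m a ha n
    rw [map_sub, PowerSeries.coeff_one]
    split_ifs with h0
    · rw [h0, coeff_zero_zexp, sub_self]
      exact zero_mem _
    · rw [sub_zero, coeff_zexp]
      split_ifs with hd
      · refine I.smul_mem _ ?_
        by_cases hq : n / m = 0
        · have h00 : n = 0 ∨ m = 0 := by
            obtain ⟨q, rfl⟩ := hd
            rcases Nat.eq_zero_or_pos m with hm | hm
            · exact Or.inr hm
            · rw [Nat.mul_div_cancel_left q hm] at hq
              exact Or.inl (by rw [hq, mul_zero])
          rcases h00 with h00 | rfl
          · exact absurd h00 h0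
          · exact absurd (Nat.eq_zero_of_zero_dvd hd) h0
        · obtain ⟨q, hq⟩ := Nat.exists_eq_succ_of_ne_zero hq
          rw [hq, pow_succ]
          exact h.mul_mem_left _ (S.pow_mem (h.le a ha) q) a ha
      · exact zero_mem _
  have hPI : ∀ N, CoeffsIn I (P N - 1) := by
    intro N
    induction N with
    | zero => exact fun n => by simp [P]
    | succ N ih =>
      have hφ : φ N ∈ I := by
        have : φ N = PowerSeries.coeff (N + 1) u - PowerSeries.coeff (N + 1) (P N - 1) := by
          simp [φ, PowerSeries.coeff_one]
        rw [this]
        exact sub_mem (hu _ N.succ_ne_zero) (ih _)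
      have e : P (N + 1) - 1 = (P N - 1) * zexp k (N + 1) (φ N) + (zexp k (N + 1) (φ N) - 1) := by
        rw [hP]
        noncomm_ring
      rw [e]
      exact (CoeffsIn.mul (fun b hb a ha => h.mul_mem_right a ha b hb) ih
        (CoeffsIn.zexp (N + 1) (h.le _ hφ))).add (hzI _ _ hφ)
  have hP0 : ∀ N, PowerSeries.coeff 0 (P N) = 1 := by
    intro N
    induction N with
    | zero => simp [P]
    | succ N ih => rw [hP, coeff_zero_mul, ih, coeff_zero_zexp, one_mul]
  refine ⟨φ, fun N => ?_, fun N => ?_⟩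
  · have : φ N = PowerSeries.coeff (N + 1) u - PowerSeries.coeff (N + 1) (P N - 1) := by
      simp [φ, PowerSeries.coeff_one]
    rw [this]
    exact sub_mem (hu _ N.succ_ne_zero) (hPI N _)
  · rw [hprod]
    induction N with
    | zero =>
      intro n hn
      obtain rfl := Nat.le_zero.1 hn
      rw [hP0, hu0]
    | succ N ih =>
      intro n hn
      have e : P (N + 1) = P N + P N * (zexp k (N + 1) (φ N) - 1) := by
        rw [hP]
        noncomm_ring
      rcases n with _ | n
      · exact (hP0 (N + 1)).trans hu0.symm
      have hz : ∀ j ≤ N, PowerSeries.coeff j (zexp k (N + 1) (φ N) - 1) = 0 := by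
        intro j hj
        rw [map_sub, PowerSeries.coeff_one]
        split_ifs with h0
        · rw [h0, coeff_zero_zexp, sub_self]
        · rw [coeff_zexp_of_lt h0 (by omega), sub_zero]
      rw [e, map_add, coeff_mul_eq_add, hP0, one_mul, Finset.sum_eq_zero, add_zero]
      · rcases Nat.lt_or_ge n N with hlt | hge
        · rw [ih _ (by omega), hz _ (by omega), add_zero]
        · obtain rfl : n = N := by omega
          rw [map_sub, coeff_self_zexp (Nat.succ_ne_zero n), PowerSeries.coeff_one,
            if_neg (Nat.succ_ne_zero n), sub_zero]
          simp [φ]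
      · intro p hp
        have hp' := Finset.HasAntidiagonal.mem_antidiagonal.1 hp
        rw [hz p.2 (by omega), mul_zero]

end TraceIdeal

/-! ### The logarithmic derivative of `e^{zf} e^{zg} e^{-z(f+g)}` -/

section ExpProd

variable {k V : Type*} [Field k] [AddCommGroup V] [Module k V]
  {S : Subalgebra k (Module.End k V)} {I : Submodule k (Module.End k V)}
  {t : Module.End k V →ₗ[k] k} {f g : Module.End k V}

theorem coeff_zero_expProd (f g : Module.End k V) :
    PowerSeries.coeff 0 (expProd f g) = 1 := by
  rw [expProd, coeff_zero_mul, coeff_zero_mul, coeff_zero_zexp, coeff_zero_zexp, coeff_zero_zexp,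
    one_mul, one_mul]

theorem coeffsIn_expProd (hf : f ∈ S) (hg : g ∈ S) :
    CoeffsIn (Subalgebra.toSubmodule S) (expProd f g) := by
  have hm : ∀ a ∈ Subalgebra.toSubmodule S, ∀ b ∈ Subalgebra.toSubmodule S,
      a * b ∈ Subalgebra.toSubmodule S := fun a ha b hb => S.mul_mem ha hb
  exact .mul hm (.mul hm (.zexp 1 hf) (.zexp 1 hg)) (.zexp 1 (S.neg_mem (S.add_mem hf hg)))

variable [CharZero k]

/-- The conjugate `e^{-zg} f e^{zg}` differs from `f` by a power series in the ideal generated by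
`[f, g]`; its coefficients have the same traces as those of `z [f, g]`. -/
theorem conj_zexp_sub (h : IsTraceIdeal S I t) (hg : g ∈ S)
    (hfg : f * g - g * f ∈ I) :
    CoeffsIn I (zexp k 1 (-g) * PowerSeries.C f * zexp k 1 g - PowerSeries.C f) ∧
    ∀ n, t (PowerSeries.coeff n (zexp k 1 (-g) * PowerSeries.C f * zexp k 1 g - PowerSeries.C f)) =
      if n = 1 then t (f * g - g * f) else 0 := by
  have hb := CoeffsIn.zexp (k := k) 1 hg
  have hb' := CoeffsIn.zexp (k := k) 1 (S.neg_mem hg)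
  have hbb := zexp_mul_zexp_neg (k := k) one_ne_zero g
  have hc := CoeffsIn.C hfg
  have hw := h.coeffsIn_conj hb hb' hc
  have hwt := h.coeff_conj hb hb' hc hbb
  have h0 : PowerSeries.coeff 0
      (zexp k 1 (-g) * PowerSeries.C f * zexp k 1 g - PowerSeries.C f) = 0 := by
    rw [map_sub, coeff_zero_mul, coeff_zero_mul, coeff_zero_zexp, coeff_zero_zexp, one_mul,
      mul_one, sub_self]
  -- The derivative is `z` times a conjugate of the constant `[f, g]`, so its coefficients lie in
  -- `I` and its trace is concentrated in degree `1`. Dividing by the degree gives both claims.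
  have he : euler (zexp k 1 (-g) * PowerSeries.C f * zexp k 1 g - PowerSeries.C f) =
      PowerSeries.X ^ 1 * (zexp k 1 (-g) * PowerSeries.C (f * g - g * f) * zexp k 1 g) := by
    rw [map_sub, euler_mul, euler_mul, euler_C, euler_zexp' one_ne_zero, euler_zexp one_ne_zero,
      one_smul, one_smul, pow_one]
    have e1 : zexp k 1 (-g) * (PowerSeries.X * PowerSeries.C (-g)) * PowerSeries.C f * zexp k 1 g =
        PowerSeries.X * (zexp k 1 (-g) * PowerSeries.C (-g * f) * zexp k 1 g) := by
      rw [← mul_assoc (zexp k 1 (-g)), (PowerSeries.commute_X (zexp k 1 (-g))).eq, map_mul]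
      simp only [mul_assoc]
    have e2 : zexp k 1 (-g) * PowerSeries.C f *
        (PowerSeries.X * (PowerSeries.C g * zexp k 1 g)) =
        PowerSeries.X * (zexp k 1 (-g) * PowerSeries.C (f * g) * zexp k 1 g) := by
      rw [← mul_assoc _ PowerSeries.X, (PowerSeries.commute_X (zexp k 1 (-g) * _)).eq, map_mul]
      simp only [mul_assoc]
    rw [mul_zero, add_zero, e1, e2, sub_zero, ← mul_add, ← add_mul, ← mul_add, ← map_add, neg_mul,
      neg_add_eq_sub]
  have hcoeff : ∀ n, (n + 1) • PowerSeries.coeff (n + 1)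
      (zexp k 1 (-g) * PowerSeries.C f * zexp k 1 g - PowerSeries.C f) =
      PowerSeries.coeff n (zexp k 1 (-g) * PowerSeries.C (f * g - g * f) * zexp k 1 g) := by
    intro n
    rw [← coeff_euler, he, pow_one, PowerSeries.coeff_succ_X_mul]
  refine ⟨?_, ?_⟩
  · rintro (_ | n)
    · rw [h0]
      exact zero_mem _
    · have h1 : ((n + 1 : ℕ) : k) ≠ 0 := Nat.cast_ne_zero.2 n.succ_ne_zero
      rw [← I.smul_mem_iff h1, Nat.cast_smul_eq_nsmul, hcoeff]
      exact hw n
  · rintro (_ | n)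
    · rw [h0, map_zero, if_neg zero_ne_one]
    · have := congrArg t (hcoeff n)
      rw [map_nsmul, hwt, PowerSeries.coeff_C] at this
      rcases n with _ | n
      · simpa using this
      · rw [if_neg n.succ_ne_zero, map_zero] at this
        rw [if_neg (by omega)]
        exact eq_zero_of_nsmul_eq_zero k (Nat.succ_ne_zero _) this

/-- Write `a`, `b`, `c` for the three factors and `y = b⁻¹ f b - f`. The terms with `g` cancel, so
the derivative is `z a (f b - b f) c = z a b y c`, and the logarithmic derivative is `c⁻¹ (z y) c`.
-/
theorem exists_isLogDeriv_expProd (h : IsTraceIdeal S I t) (hf : f ∈ S) (hg : g ∈ S)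
    (hfg : f * g - g * f ∈ I) :
    ∃ w, IsLogDeriv I (expProd f g) w ∧
      ∀ n, t (PowerSeries.coeff (n + 1) w) = if n = 1 then t (f * g - g * f) else 0 := by
  obtain ⟨hy, hyt⟩ := conj_zexp_sub h hg hfg
  set y := zexp k 1 (-g) * PowerSeries.C f * zexp k 1 g - PowerSeries.C f with hydef
  have hs := S.add_mem hf hg
  have hc := CoeffsIn.zexp (k := k) 1 (S.neg_mem hs)
  have hc' := CoeffsIn.zexp (k := k) 1 hs
  have hcc := zexp_neg_mul_zexp (k := k) one_ne_zero (f + g)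
  have hXy := hy.X_pow_mul 1
  refine ⟨zexp k 1 (f + g) * (PowerSeries.X ^ 1 * y) * zexp k 1 (-(f + g)),
    ⟨?_, h.coeffsIn_conj hc hc' hXy⟩, fun n => ?_⟩
  · have hb : zexp k 1 g * y = PowerSeries.C f * zexp k 1 g - zexp k 1 g * PowerSeries.C f := by
      rw [hydef, mul_sub, mul_assoc (zexp k 1 (-g)), ← mul_assoc (zexp k 1 g) (zexp k 1 (-g)),
        zexp_mul_zexp_neg one_ne_zero, one_mul]
    have hX : ∀ u : PowerSeries (Module.End k V), u * PowerSeries.X = PowerSeries.X * u :=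
      fun u => (PowerSeries.commute_X u).eq
    have e1 : expProd f g *
        (zexp k 1 (f + g) * (PowerSeries.X ^ 1 * y) * zexp k 1 (-(f + g))) =
        PowerSeries.X * (zexp k 1 f * (zexp k 1 g * y) * zexp k 1 (-(f + g))) := by
      calc _ = zexp k 1 f * zexp k 1 g * (zexp k 1 (-(f + g)) * zexp k 1 (f + g)) *
            PowerSeries.X * y * zexp k 1 (-(f + g)) := by
            simp only [expProd, pow_one, mul_assoc]
        _ = _ := by
            rw [hcc, mul_one, hX]
            simp only [mul_assoc]
    rw [e1, hb, expProd, euler_mul, euler_mul, euler_zexp' one_ne_zero f,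
      euler_zexp one_ne_zero g, euler_zexp one_ne_zero (-(f + g)), one_smul, one_smul, one_smul,
      pow_one]
    have s1 : zexp k 1 f * (PowerSeries.X * PowerSeries.C f) * zexp k 1 g * zexp k 1 (-(f + g)) =
        PowerSeries.X *
          (zexp k 1 f * (PowerSeries.C f * zexp k 1 g) * zexp k 1 (-(f + g))) := by
      rw [← mul_assoc (zexp k 1 f) PowerSeries.X, hX]
      simp only [mul_assoc]
    have s2 : zexp k 1 f * (PowerSeries.X * (PowerSeries.C g * zexp k 1 g)) *
        zexp k 1 (-(f + g)) =
        PowerSeries.X *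
          (zexp k 1 f * (zexp k 1 g * PowerSeries.C g) * zexp k 1 (-(f + g))) := by
      rw [← mul_assoc (zexp k 1 f) PowerSeries.X, hX,
        (commute_C_zexp (k := k) 1 (Commute.refl g)).eq]
      simp only [mul_assoc]
    have s3 : zexp k 1 f * zexp k 1 g *
        (PowerSeries.X * (PowerSeries.C (-(f + g)) * zexp k 1 (-(f + g)))) =
        PowerSeries.X *
          (zexp k 1 f * (zexp k 1 g * PowerSeries.C (-(f + g))) * zexp k 1 (-(f + g))) := by
      rw [← mul_assoc _ PowerSeries.X, hX]
      simp only [mul_assoc]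
    rw [add_mul, s1, s2, s3, ← mul_add, ← mul_add, ← add_mul, ← add_mul, ← mul_add, ← mul_add,
      map_neg, map_add]
    noncomm_ring
  · rw [h.coeff_conj hc hc' hXy hcc, pow_one, PowerSeries.coeff_succ_X_mul, hyt]

/-- The exponents in an expansion of `e^{zf} e^{zg} e^{-z(f+g)}` as a product of exponentials have
trace `0`, except for the one of `exp_{z²}`, which has trace `½ t [f, g]`. -/
theorem trace_of_expansion (h : IsTraceIdeal S I t) (hf : f ∈ S) (hg : g ∈ S)
    (hfg : f * g - g * f ∈ I) (φ : ℕ → Module.End k V) (hφ : ∀ i, φ i ∈ I)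
    (hconv : ∀ n : ℕ, ∀ᶠ N in Filter.atTop, PowerSeries.coeff n
      (orderedProd (fun i => zexp k (i + 1) (φ i)) N) = PowerSeries.coeff n (expProd f g)) (n : ℕ) :
    t (φ n) = if n = 1 then (1 / 2 : k) * t (f * g - g * f) else 0 := by
  obtain ⟨w, hw, hwt⟩ := exists_isLogDeriv_expProd h hf hg hfg
  have hev : ∀ᶠ N in Filter.atTop, ∀ j ∈ Finset.range (n + 2), PowerSeries.coeff j
      (orderedProd (fun i => zexp k (i + 1) (φ i)) N) = PowerSeries.coeff j (expProd f g) :=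
    (Filter.eventually_all_finset _).2 fun j _ => hconv j
  obtain ⟨N, hN, hnN⟩ := (hev.and (Filter.eventually_gt_atTop n)).exists
  obtain ⟨w', hw', hwt'⟩ := exists_isLogDeriv_orderedProd h φ hφ N
  have h0 : PowerSeries.coeff 0 (orderedProd (fun i => zexp k (i + 1) (φ i)) N) = 1 := by
    rw [hN 0 (by simp), coeff_zero_expProd]
  have hww : PowerSeries.coeff (n + 1) w' = PowerSeries.coeff (n + 1) w :=
    hw'.coeff_eq hw h0 (coeff_zero_expProd f g)
      fun j hj => hN j (Finset.mem_range.2 (by omega))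
  -- The identity is `(n + 1) t (φ n) = t (coeff (n + 1) w)`. For `n = 1`, the exponent of
  -- `exp_{z²}`, the factor `n + 1 = 2` produces the one half.
  have key := hwt' n
  rw [hww, hwt, if_pos hnN, ← Nat.cast_smul_eq_nsmul k, smul_eq_mul] at key
  have h1 : ((n + 1 : ℕ) : k) ≠ 0 := Nat.cast_ne_zero.2 n.succ_ne_zero
  split_ifs at key ⊢ with hn
  · subst hn
    rw [key]
    push_cast
    ring
  · exact (mul_eq_zero.1 key.symm).resolve_left h1

theorem coeff_expProd_mem (h : IsTraceIdeal S I t) (hf : f ∈ S) (hg : g ∈ S)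
    (hfg : f * g - g * f ∈ I) {n : ℕ} (hn : n ≠ 0) : PowerSeries.coeff n (expProd f g) ∈ I := by
  obtain ⟨w, hw, -⟩ := exists_isLogDeriv_expProd h hf hg hfg
  have h1 : (n : k) ≠ 0 := Nat.cast_ne_zero.2 hn
  rw [← I.smul_mem_iff h1, Nat.cast_smul_eq_nsmul, ← coeff_euler, hw.euler_eq]
  exact CoeffsIn.mul h.mul_mem_left (coeffsIn_expProd hf hg) hw.coeffsIn n

end ExpProd

/-! ### Jacobi's formula -/

section Jacobi

variable {R n : Type*} [CommRing R] [Fintype n] [DecidableEq n]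

/-- The ring homomorphism `r ↦ r + ε D(r)` to the dual numbers attached to a derivation `D`. -/
def dualNumberHom (D : R →+ R) (hD : ∀ a b, D (a * b) = D a * b + a * D b) :
    R →+* TrivSqZeroExt R R where
  toFun r := TrivSqZeroExt.inl r + TrivSqZeroExt.inr (D r)
  map_one' := by
    have h := hD 1 1
    rw [one_mul, mul_one, one_mul, left_eq_add] at h
    rw [h, TrivSqZeroExt.inr_zero, add_zero, TrivSqZeroExt.inl_one]
  map_mul' a b := by
    ext
    · simp
    · simp [hD]
      ring
  map_zero' := by simp
  map_add' a b := by
    ext <;> simp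

/-- Jacobi's formula for the derivative of a determinant. -/
theorem derivation_det (D : R →+ R) (hD : ∀ a b, D (a * b) = D a * b + a * D b)
    (M N : Matrix n n R) (h : M.map D = N * M) : D M.det = N.trace * M.det := by
  let ε : TrivSqZeroExt R R := TrivSqZeroExt.inr 1
  let i : R →+* TrivSqZeroExt R R := TrivSqZeroExt.inlHom R R
  have hε : ε ^ 2 = 0 := by
    rw [pow_two]
    exact TrivSqZeroExt.inr_mul_inr R 1 1
  -- Over the dual numbers the hypothesis says that `M + ε D M` equals `(1 + ε N) M`; since `ε² =
  -- 0`, `det (1 + ε N) = 1 + ε tr N`.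
  have hM : (dualNumberHom D hD).mapMatrix M = (1 + ε • i.mapMatrix N) * i.mapMatrix M := by
    rw [add_mul, one_mul, Matrix.smul_mul, ← map_mul, ← h]
    ext a b
    · simp [dualNumberHom, i, ε]
    · simp [dualNumberHom, i, ε]
  have hdet := congrArg Matrix.det hM
  rw [← RingHom.map_det, Matrix.det_mul, Matrix.det_one_add_smul, hε, mul_zero, add_zero,
    ← RingHom.map_det] at hdet
  have htr : (i.mapMatrix N).trace = i N.trace := by
    simp [Matrix.trace, map_sum]
  rw [htr] at hdet
  have := congrArg TrivSqZeroExt.snd hdet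
  simpa [dualNumberHom, i, ε, mul_comm] using this

end Jacobi

/-! ### Determinants of products of operators congruent to `1` modulo `E₀` -/

section Unipotent

variable {F M N : Type*} [Field F] [AddCommGroup M] [Module F M] [AddCommGroup N] [Module F N]

theorem detOneAdd_sub_one_eq_of_injective [FiniteDimensional F N] (T : Module.End F M)
    (ι : N →ₗ[F] M) (hι : Function.Injective ι) (T' : Module.End F N)
    (h : ∀ x, T (ι x) = ι (T' x)) (n : ℕ)
    (hn : LinearMap.range ((T - 1) ^ n) ≤ LinearMap.range ι) :
    detOneAdd (T - 1) = LinearMap.det T' := by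
  rw [detOneAdd_eq_of_injective (T - 1) ι hι (T' - 1) (fun x => by simp [h]) n hn, add_sub_cancel]

theorem detOneAdd_orderedProd_sub_one {Mp : Submodule F M} (T : ℕ → Module.End F M)
    (hT : ∀ i, T i - 1 ∈ tateIdealZero Mp) (N : ℕ) :
    orderedProd T N - 1 ∈ tateIdealZero Mp ∧
      detOneAdd (orderedProd T N - 1) = ∏ i ∈ Finset.range N, detOneAdd (T i - 1) := by
  induction N with
  | zero =>
    rw [orderedProd_zero, sub_self, Finset.prod_range_zero]
    refine ⟨zero_mem _, ?_⟩
    rw [detOneAdd_eq 0 ⊥ (by simp) 1 (by simp)]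
    exact LinearMap.det_eq_one_of_subsingleton _
  | succ N ih =>
    have e : orderedProd T (N + 1) - 1 = (1 + (orderedProd T N - 1)) * (1 + (T N - 1)) - 1 := by
      rw [add_sub_cancel, add_sub_cancel, orderedProd_succ]
    rw [Finset.prod_range_succ, ← ih.2, ← detOneAdd_mul ih.1 (hT N), ← e]
    refine ⟨?_, rfl⟩
    have e' : orderedProd T (N + 1) - 1 =
        (orderedProd T N - 1) + (T N - 1) + (orderedProd T N - 1) * (T N - 1) := by
      rw [orderedProd_succ]
      noncomm_ring
    rw [e']
    exact add_mem (add_mem ih.1 (hT N)) (mul_mem_tateIdealZero (tateIdealOne_le ih.1.1) (hT N))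

end Unipotent

-- Operators on `V_z` given by power series

local instance laurentAlgebra {k : Type*} [Field k] : Algebra k (LaurentSeries k) :=
  HahnSeries.instAlgebra

section BaseChange

variable {k V V' : Type*} [Field k] [AddCommGroup V] [Module k V] [AddCommGroup V'] [Module k V']

theorem zcoeff_tmul (n : ℤ) (a : LaurentSeries k) (v : V) :
    zcoeff n (a ⊗ₜ[k] v) = a.coeff n • v := by
  simp [zcoeff]

theorem zcoeff_baseChange (n : ℤ) (f : V →ₗ[k] V') (x : LaurentSeries k ⊗[k] V) :
    zcoeff n (f.baseChange (LaurentSeries k) x) = f (zcoeff n x) := by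
  induction x using TensorProduct.induction_on with
  | zero => simp
  | tmul a v => rw [LinearMap.baseChange_tmul, zcoeff_tmul, zcoeff_tmul, map_smul]
  | add x y hx hy => rw [map_add, map_add, map_add, map_add, hx, hy]

theorem coeff_baseChange_repr {ι : Type*} (b : Module.Basis ι k V) (i : ι) (n : ℤ)
    (x : LaurentSeries k ⊗[k] V) :
    ((b.baseChange (LaurentSeries k)).repr x i).coeff n = b.repr (zcoeff n x) i := by
  induction x using TensorProduct.induction_on with
  | zero => simp
  | tmul a v =>
    rw [Module.Basis.baseChange_repr_tmul, zcoeff_tmul, map_smul, HahnSeries.coeff_smul,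
      Finsupp.smul_apply, smul_eq_mul, smul_eq_mul, mul_comm]
  | add x y hx hy =>
    rw [map_add, map_add, map_add, Finsupp.add_apply, Finsupp.add_apply, HahnSeries.coeff_add, hx,
      hy]

theorem zcoeff_ext {x y : LaurentSeries k ⊗[k] V} (h : ∀ n, zcoeff n x = zcoeff n y) : x = y := by
  refine Module.Basis.ext_elem ((Module.Basis.ofVectorSpace k V).baseChange (LaurentSeries k))
    fun i => ?_
  ext n
  rw [coeff_baseChange_repr, coeff_baseChange_repr, h]

/-- The base change of a projection onto `U` fixes `x`, as is seen on coefficients, and its image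
lies in the base change of `U`. -/
theorem mem_baseChange_of_zcoeff_mem {U : Submodule k V} {x : LaurentSeries k ⊗[k] V}
    (h : ∀ n, zcoeff n x ∈ U) : x ∈ U.baseChange (LaurentSeries k) := by
  have hx : (proj U).baseChange (LaurentSeries k) x = x :=
    zcoeff_ext fun n => by rw [zcoeff_baseChange, proj_apply_of_mem (h n)]
  rw [← hx]
  clear hx h
  induction x using TensorProduct.induction_on with
  | zero => rw [map_zero]; exact zero_mem _
  | tmul a v =>
    rw [LinearMap.baseChange_tmul]
    exact Submodule.tmul_mem_baseChange_of_mem a (proj_apply_mem v)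
  | add x y hx hy => rw [map_add]; exact add_mem hx hy

theorem coeff_coe_of_neg (p : PowerSeries k) {n : ℤ} (hn : n < 0) :
    (p : LaurentSeries k).coeff n = 0 := by
  rw [PowerSeries.coeff_coe, if_pos hn]

/-- The algebraic tensor product contains only series whose coefficients span a finite-dimensional
space; within such a space every sequence of coefficients occurs. -/
theorem exists_zcoeff_eq (W : Submodule k V) [FiniteDimensional k W] (s : ℕ → V)
    (hs : ∀ n, s n ∈ W) : ∃ x : LaurentSeries k ⊗[k] V,
      (∀ n : ℕ, zcoeff (n : ℤ) x = s n) ∧ ∀ n : ℤ, n < 0 → zcoeff n x = 0 := by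
  let b := Module.finBasis k W
  refine ⟨∑ i, ((PowerSeries.mk fun n => b.repr ⟨s n, hs n⟩ i : PowerSeries k) :
    LaurentSeries k) ⊗ₜ[k] (b i : V), fun n => ?_, fun n hn => ?_⟩
  · have := congrArg Subtype.val (b.sum_repr ⟨s n, hs n⟩)
    rw [Submodule.coe_sum] at this
    simpa [zcoeff_tmul, LaurentSeries.coeff_coe_powerSeries] using this
  · rw [map_sum]
    exact Finset.sum_eq_zero fun i _ => by rw [zcoeff_tmul, coeff_coe_of_neg _ hn, zero_smul]

/-- A power series whose coefficients generate a finite-dimensional space from every vector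
defines an operator on `V_z`. -/
theorem exists_isGivenBy (u : PowerSeries (Module.End k V))
    (hu : ∀ v : V, ∃ W : Submodule k V, FiniteDimensional k W ∧
      ∀ n, PowerSeries.coeff n u v ∈ W) :
    ∃ T : Module.End (LaurentSeries k) (LaurentSeries k ⊗[k] V), IsGivenBy T u := by
  let b := Module.Basis.ofVectorSpace k V
  have hx : ∀ v : V, ∃ x : LaurentSeries k ⊗[k] V,
      (∀ n : ℕ, zcoeff (n : ℤ) x = PowerSeries.coeff n u v) ∧
        ∀ n : ℤ, n < 0 → zcoeff n x = 0 := fun v => by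
    obtain ⟨W, hW, h⟩ := hu v
    exact exists_zcoeff_eq W _ h
  choose x hx hx' using hx
  let T : Module.End (LaurentSeries k) (LaurentSeries k ⊗[k] V) :=
    (b.baseChange (LaurentSeries k)).constr (LaurentSeries k) fun i => x (b i)
  have hT : ∀ i, T (1 ⊗ₜ[k] b i) = x (b i) := fun i => by
    rw [← Module.Basis.baseChange_apply, Module.Basis.constr_basis]
  let Tk : V →ₗ[k] LaurentSeries k ⊗[k] V :=
    { toFun := fun v => T (1 ⊗ₜ[k] v)
      map_add' := fun v w => by rw [TensorProduct.tmul_add, map_add]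
      map_smul' := fun c v => by
        rw [TensorProduct.tmul_smul, LinearMap.map_smul_of_tower, RingHom.id_apply] }
  refine ⟨T, fun v => ⟨fun n => ?_, fun n hn => ?_⟩⟩
  · have : zcoeff (n : ℤ) ∘ₗ Tk = PowerSeries.coeff n u := b.ext fun i => by
      change zcoeff (n : ℤ) (T (1 ⊗ₜ[k] b i)) = _
      rw [hT, hx]
    exact LinearMap.congr_fun this v
  · have : zcoeff n ∘ₗ Tk = 0 := b.ext fun i => by
      change zcoeff n (T (1 ⊗ₜ[k] b i)) = _
      rw [hT, hx' _ n hn, LinearMap.zero_apply]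
    exact LinearMap.congr_fun this v

/-- A property of `T - 1`, for `T` given by a power series with constant term `1`. -/
theorem IsGivenBy.sub_one_mem {T : Module.End (LaurentSeries k) (LaurentSeries k ⊗[k] V)}
    {u : PowerSeries (Module.End k V)} (hT : IsGivenBy T u) (hu : PowerSeries.coeff 0 u = 1)
    {A U : Submodule k V} (h : ∀ v ∈ A, ∀ n ≠ 0, PowerSeries.coeff n u v ∈ U) :
    ∀ x ∈ A.baseChange (LaurentSeries k), (T - 1) x ∈ U.baseChange (LaurentSeries k) := by
  suffices h' : A.baseChange (LaurentSeries k) ≤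
      (U.baseChange (LaurentSeries k)).comap (T - 1) from fun x hx => h' hx
  rw [Submodule.baseChange_eq_span, Submodule.span_le]
  rintro _ ⟨v, hv, rfl⟩
  refine mem_baseChange_of_zcoeff_mem fun n => ?_
  change zcoeff n (T (1 ⊗ₜ[k] v) - 1 ⊗ₜ[k] v) ∈ U
  rw [map_sub, zcoeff_tmul]
  rcases lt_or_ge n 0 with hn | hn
  · rw [(hT v).2 n hn, HahnSeries.coeff_one, if_neg hn.ne, zero_smul, sub_self]
    exact zero_mem _
  · obtain ⟨n, rfl⟩ := Int.eq_ofNat_of_zero_le hn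
    rw [(hT v).1 n, HahnSeries.coeff_one]
    rcases eq_or_ne n 0 with rfl | h0
    · rw [hu]
      simp
    · rw [if_neg (by exact_mod_cast h0), zero_smul, sub_zero]
      exact h v hv n h0

theorem coeff_zexp_apply_mem (m : ℕ) {φ : Module.End k V} {v : V} {U : Submodule k V}
    (h : ∀ j, (φ ^ (j + 1)) v ∈ U) {n : ℕ} (hn : n ≠ 0) :
    PowerSeries.coeff n (zexp k (m + 1) φ) v ∈ U := by
  rw [coeff_zexp]
  split_ifs with hd
  · obtain ⟨q, rfl⟩ := hd
    rw [Nat.mul_div_cancel_left q m.succ_pos, LinearMap.smul_apply]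
    obtain ⟨j, rfl⟩ := Nat.exists_eq_succ_of_ne_zero (right_ne_zero_of_mul hn)
    exact U.smul_mem _ (h j)
  · exact zero_mem _

/-- Finite potency keeps the orbit of each vector in a finite-dimensional space: the first `N`
iterates together with the range of `φ^N`. -/
theorem exists_isGivenBy_zexp (m : ℕ) {φ : Module.End k V} (hφ : IsFinitePotent φ) :
    ∃ T : Module.End (LaurentSeries k) (LaurentSeries k ⊗[k] V),
      IsGivenBy T (zexp k (m + 1) φ) := by
  obtain ⟨N, hN⟩ := hφ
  refine exists_isGivenBy _ fun v => ?_
  let X : Submodule k V := Submodule.span k (Set.range fun j : Fin N => (φ ^ (j : ℕ)) v)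
  have hX : FiniteDimensional k X := FiniteDimensional.span_of_finite k (Set.finite_range _)
  refine ⟨LinearMap.range (φ ^ N) ⊔ X, inferInstance, ?_⟩
  have hpow : ∀ j, (φ ^ j) v ∈ LinearMap.range (φ ^ N) ⊔ X := by
    intro j
    rcases lt_or_ge j N with hj | hj
    · exact Submodule.mem_sup_right (Submodule.subset_span ⟨⟨j, hj⟩, rfl⟩)
    · refine Submodule.mem_sup_left ⟨(φ ^ (j - N)) v, ?_⟩
      rw [← Module.End.mul_apply, ← pow_add, Nat.add_sub_cancel' hj]
  intro n
  rcases eq_or_ne n 0 with rfl | hn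
  · rw [coeff_zero_zexp]
    exact hpow 0
  · exact coeff_zexp_apply_mem m (fun j => hpow (j + 1)) hn

theorem tateLT_map_of_le {F M : Type*} [Field F] [AddCommGroup M] [Module F M]
    {A B X : Submodule F M} [FiniteDimensional F X] (h : A ≤ B ⊔ X) : TateLT A B :=
  tateLT_iff.2 ⟨X, inferInstance, h⟩

instance finiteDimensional_baseChange (W : Submodule k V) [FiniteDimensional k W] :
    FiniteDimensional (LaurentSeries k) (W.baseChange (LaurentSeries k)) :=
  Module.Finite.range _

theorem baseChange_sup_le (U W : Submodule k V) : (U ⊔ W).baseChange (LaurentSeries k) ≤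
    U.baseChange (LaurentSeries k) ⊔ W.baseChange (LaurentSeries k) := by
  rw [Submodule.baseChange_eq_span, Submodule.span_le]
  rintro _ ⟨v, hv, rfl⟩
  obtain ⟨u, hu, w, hw, rfl⟩ := Submodule.mem_sup.1 hv
  rw [map_add]
  exact Submodule.add_mem_sup (Submodule.tmul_mem_baseChange_of_mem _ hu)
    (Submodule.tmul_mem_baseChange_of_mem _ hw)

/-- All nonconstant coefficients of the exponential are multiples of positive powers of `φ`, so the
inclusions for `φ` pass to `T - 1`. The theory over `k((z))` then applies to `V_z`, with the base
change of `V₊` in the role of `V₊`. -/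
theorem IsGivenBy.sub_one_mem_tateIdealZero {Vp : Submodule k V} {m : ℕ} {φ : Module.End k V}
    (hφ : φ ∈ tateIdealZero Vp) {T : Module.End (LaurentSeries k) (LaurentSeries k ⊗[k] V)}
    (hT : IsGivenBy T (zexp k (m + 1) φ)) :
    T - 1 ∈ tateIdealZero (Vp.baseChange (LaurentSeries k)) := by
  obtain ⟨X, hX, h1⟩ := tateLT_iff.1 hφ.1
  obtain ⟨Y, hY, h2⟩ := tateLT_iff.1 hφ.2
  rw [bot_sup_eq] at h2
  have hV : ∀ v, φ v ∈ Vp ⊔ X := fun v => h1 ⟨v, trivial, rfl⟩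
  have hU : Vp ⊔ X ≤ (Y ⊔ X.map φ).comap φ :=
    sup_le (fun x hx => Submodule.mem_sup_left (h2 ⟨x, hx, rfl⟩))
      (fun x hx => Submodule.mem_sup_right ⟨x, hx, rfl⟩)
  refine ⟨tateLT_map_of_le (X := X.baseChange (LaurentSeries k))
    (le_trans ?_ (baseChange_sup_le Vp X)),
    tateLT_map_of_le (X := (Y ⊔ X.map φ).baseChange (LaurentSeries k)) (le_trans ?_ le_sup_right)⟩
  · rintro _ ⟨x, -, rfl⟩
    refine hT.sub_one_mem (coeff_zero_zexp _ _) (A := ⊤) (fun v _ n hn => ?_) x ?_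
    · refine coeff_zexp_apply_mem m (fun j => ?_) hn
      rw [pow_succ', Module.End.mul_apply]
      exact hV _
    · rw [Submodule.baseChange_top]
      trivial
  · rintro _ ⟨x, hx, rfl⟩
    refine hT.sub_one_mem (coeff_zero_zexp _ _) (A := Vp) (fun v hv n hn => ?_) x hx
    refine coeff_zexp_apply_mem m (fun j => ?_) hn
    rw [pow_succ', Module.End.mul_apply]
    refine hU ?_
    rcases j with _ | j
    · exact Submodule.mem_sup_left hv
    · rw [pow_succ', Module.End.mul_apply]
      exact hV _

end BaseChange

/-! ### The determinant of an exponential is the exponential of the trace -/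

section Determinant

variable {k W : Type*} [Field k] [CharZero k] [AddCommGroup W] [Module k W]

/-- The determinant of `exp_{z^m}(φ)` on a finite-dimensional space. -/
theorem IsGivenBy.det_eq [FiniteDimensional k W] {m : ℕ} (φ : Module.End k W)
    {T : Module.End (LaurentSeries k) (LaurentSeries k ⊗[k] W)}
    (hT : IsGivenBy T (zexp k (m + 1) φ)) :
    LinearMap.det T = ((zexp k (m + 1) (LinearMap.trace k W φ) : PowerSeries k) :
      LaurentSeries k) := by
  classical
  let b := Module.finBasis k W
  let B := LinearMap.toMatrixAlgEquiv b φ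
  let P : Matrix (Fin (Module.finrank k W)) (Fin (Module.finrank k W)) (PowerSeries k) :=
    Matrix.of fun i j => PowerSeries.mk fun n =>
      LinearMap.toMatrixAlgEquiv b (PowerSeries.coeff n (zexp k (m + 1) φ)) i j
  have hPc : ∀ n i j, PowerSeries.coeff n (P i j) =
      LinearMap.toMatrixAlgEquiv b (PowerSeries.coeff n (zexp k (m + 1) φ)) i j := fun n i j =>
    PowerSeries.coeff_mk n fun n =>
      LinearMap.toMatrixAlgEquiv b (PowerSeries.coeff n (zexp k (m + 1) φ)) i j
  have hP : LinearMap.toMatrix (b.baseChange (LaurentSeries k)) (b.baseChange (LaurentSeries k)) T =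
      (HahnSeries.ofPowerSeries ℤ k).mapMatrix P := by
    ext i j n
    rw [LinearMap.toMatrix_apply, coeff_baseChange_repr, Module.Basis.baseChange_apply,
      RingHom.mapMatrix_apply, Matrix.map_apply]
    rcases lt_or_ge n 0 with hn | hn
    · rw [(hT (b j)).2 n hn, coeff_coe_of_neg _ hn, map_zero, Finsupp.zero_apply]
    · obtain ⟨n, rfl⟩ := Int.eq_ofNat_of_zero_le hn
      rw [(hT (b j)).1 n, LaurentSeries.coeff_coe_powerSeries, hPc,
        LinearMap.toMatrixAlgEquiv_apply]
  rw [← LinearMap.det_toMatrix (b.baseChange (LaurentSeries k)), hP, ← RingHom.map_det]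
  congr 1
  -- The matrix `P` of the exponential satisfies `euler P = Q P`. By Jacobi's formula `det P` solves
  -- the scalar equation with coefficient `tr Q`, which is also the equation of the exponential of
  -- the trace.
  let Q : Matrix (Fin (Module.finrank k W)) (Fin (Module.finrank k W)) (PowerSeries k) :=
    (PowerSeries.X ^ (m + 1) : PowerSeries k) • ((m + 1) • B).map PowerSeries.C
  have hQ : P.map euler = Q * P := by
    ext i j n
    rw [Matrix.map_apply, coeff_euler, hPc, ← Matrix.smul_apply, ← map_nsmul, ← coeff_euler,
      euler_zexp m.succ_ne_zero, PowerSeries.coeff_X_pow_mul', Matrix.smul_mul, Matrix.smul_apply,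
      smul_eq_mul, PowerSeries.coeff_X_pow_mul']
    split_ifs
    · rw [PowerSeries.coeff_C_mul, map_mul, Matrix.mul_apply, Matrix.mul_apply, map_sum]
      refine Finset.sum_congr rfl fun l _ => ?_
      rw [Matrix.map_apply, PowerSeries.coeff_C_mul, hPc, map_nsmul]
    · simp
  refine eq_of_euler_eq k m.succ_ne_zero ((m + 1) • LinearMap.trace k W φ) ?_ ?_
    (euler_zexp m.succ_ne_zero _)
  · have h1 : PowerSeries.constantCoeff.mapMatrix P = 1 := by
      ext i j
      rw [RingHom.mapMatrix_apply, Matrix.map_apply, ← PowerSeries.coeff_zero_eq_constantCoeff_apply,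
        hPc, coeff_zero_zexp, map_one]
    rw [coeff_zero_zexp, PowerSeries.coeff_zero_eq_constantCoeff_apply, RingHom.map_det, h1,
      Matrix.det_one]
  · have htr : Q.trace = PowerSeries.X ^ (m + 1) *
        PowerSeries.C ((m + 1) • LinearMap.trace k W φ) := by
      rw [Matrix.trace_smul, smul_eq_mul, LinearMap.trace_eq_matrix_trace k b,
        ← Matrix.trace_smul, Matrix.trace, Matrix.trace, map_sum]
      rfl
    rw [derivation_det euler euler_mul P Q hQ, htr, mul_assoc]

/-- The determinant of `exp_{z^m}(φ)` for `φ ∈ E₀`. -/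
theorem IsGivenBy.detOneAdd_sub_one_eq {Vp : Submodule k W} {m : ℕ} {φ : Module.End k W}
    (hφ : φ ∈ tateIdealZero Vp) {T : Module.End (LaurentSeries k) (LaurentSeries k ⊗[k] W)}
    (hT : IsGivenBy T (zexp k (m + 1) φ)) :
    detOneAdd (T - 1) = ((zexp k (m + 1) (tateTrace φ) : PowerSeries k) : LaurentSeries k) := by
  obtain ⟨U, X, hX, hXU, h, -⟩ := exists_lowersTo hφ hφ
  have hφX := h.mapsTo hXU
  -- The determinant is computed on the base change of the finite-dimensional `X`. This suffices
  -- because `T - 1` maps `V_z` to `U_z` and `U_z` to `X_z`, so that its square has range in `X_z`.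
  obtain ⟨T', hT'⟩ := exists_isGivenBy_zexp m (φ := φ.restrict hφX)
    ⟨0, inferInstance⟩
  have hinj : Function.Injective (X.subtype.baseChange (LaurentSeries k)) :=
    Module.Flat.lTensor_preserves_injective_linearMap (M := LaurentSeries k) X.subtype
      X.injective_subtype
  have hcoeff : ∀ (n : ℕ) (w : X), ((PowerSeries.coeff n (zexp k (m + 1) (φ.restrict hφX)) w : X) :
      W) = PowerSeries.coeff n (zexp k (m + 1) φ) (w : W) := by
    intro n w
    rw [coeff_zexp, coeff_zexp]
    split_ifs
    · rw [Module.End.pow_restrict]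
      rfl
    · rfl
  have hTT : ∀ x, T (X.subtype.baseChange (LaurentSeries k) x) =
      X.subtype.baseChange (LaurentSeries k) (T' x) := by
    suffices hs : T ∘ₗ X.subtype.baseChange (LaurentSeries k) =
        X.subtype.baseChange (LaurentSeries k) ∘ₗ T' from LinearMap.congr_fun hs
    ext w
    change T (1 ⊗ₜ[k] (w : W)) = X.subtype.baseChange (LaurentSeries k) (T' (1 ⊗ₜ[k] w))
    refine zcoeff_ext fun n => ?_
    rw [zcoeff_baseChange]
    rcases lt_or_ge n 0 with hn | hn
    · rw [(hT _).2 n hn, (hT' w).2 n hn, map_zero]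
    · obtain ⟨n, rfl⟩ := Int.eq_ofNat_of_zero_le hn
      rw [(hT _).1 n, (hT' w).1 n]
      exact (hcoeff n w).symm
  have hpow : ∀ v, ∀ j, (φ ^ (j + 1)) v ∈ U := fun v j => by
    rw [pow_succ', Module.End.mul_apply]
    exact h.1 _
  have hpow' : ∀ u ∈ U, ∀ j, (φ ^ (j + 1)) u ∈ X := fun u hu j => by
    rw [pow_succ', Module.End.mul_apply]
    rcases j with _ | j
    · exact h.2 _ hu
    · exact h.2 _ (hpow u j)
  rw [tateTrace_eq φ X hφX 2 h.range_sq_le, ← hT'.det_eq]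
  refine detOneAdd_sub_one_eq_of_injective T (X.subtype.baseChange (LaurentSeries k)) hinj T'
    hTT 2 ?_
  rintro _ ⟨x, rfl⟩
  rw [pow_two, Module.End.mul_apply]
  refine hT.sub_one_mem (coeff_zero_zexp _ _) (A := U)
    (fun v hv n hn => coeff_zexp_apply_mem m (hpow' v hv) hn) _ ?_
  refine hT.sub_one_mem (coeff_zero_zexp _ _) (A := ⊤)
    (fun v hv n hn => coeff_zexp_apply_mem m (hpow v) hn) _ ?_
  rw [Submodule.baseChange_top]
  trivial

/-- The determinant of a product of exponentials. -/
theorem detOneAdd_orderedProd {Vp : Submodule k W} (φ : ℕ → Module.End k W)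
    (hφ : ∀ i, φ i ∈ tateIdealZero Vp)
    (T : ℕ → Module.End (LaurentSeries k) (LaurentSeries k ⊗[k] W))
    (hT : ∀ i, IsGivenBy (T i) (zexp k (i + 1) (φ i))) (N : ℕ) :
    orderedProd T N - 1 ∈ tateIdealZero (Vp.baseChange (LaurentSeries k)) ∧
    detOneAdd (orderedProd T N - 1) = ∏ i ∈ Finset.range N,
      ((zexp k (i + 1) (tateTrace (φ i)) : PowerSeries k) : LaurentSeries k) := by
  obtain ⟨h1, h2⟩ := detOneAdd_orderedProd_sub_one T
    (fun i => (hT i).sub_one_mem_tateIdealZero (hφ i)) N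
  exact ⟨h1, h2.trans (Finset.prod_congr rfl fun i _ => (hT i).detOneAdd_sub_one_eq (hφ i))⟩

end Determinant

/-! ### Existence, uniqueness and value of the determinant -/

section Determinants

variable {k V : Type*} [Field k] [AddCommGroup V] [Module k V] {Vp : Submodule k V}

theorem exists_isTraceIdeal (Vp : Submodule k V) : ∃ t : Module.End k V →ₗ[k] k,
    IsTraceIdeal (tateAlgebra Vp) (tateIdealZero Vp) t ∧
      ∀ φ ∈ tateIdealZero Vp, t φ = tateTrace φ := by
  obtain ⟨t, ht⟩ := exists_traceExtension Vp
  refine ⟨t, ⟨fun b hb => tateIdealOne_le hb.1, fun a ha b hb => mul_mem_tateIdealZero ha hb,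
    fun a ha b hb => mul_mem_tateIdealZero' ha hb, fun a ha b hb => ?_⟩, ht⟩
  rw [ht _ (mul_mem_tateIdealZero ha hb), ht _ (mul_mem_tateIdealZero' ha hb)]
  exact tateTrace_mul_comm a b (isFinitePotent_of_mem (mul_mem_tateIdealZero ha hb))

variable [CharZero k]

theorem detOneAdd_orderedProd_of_tateTrace_eq {φ : ℕ → Module.End k V}
    (hφ : ∀ i, φ i ∈ tateIdealZero Vp) {τ : k}
    (htr : ∀ i, tateTrace (φ i) = if i = 1 then τ else 0)
    {T : ℕ → Module.End (LaurentSeries k) (LaurentSeries k ⊗[k] V)}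
    (hT : ∀ i, IsGivenBy (T i) (zexp k (i + 1) (φ i))) {N : ℕ} (hN : 2 ≤ N) :
    detOneAdd (orderedProd T N - 1) = ((zexp k 2 τ : PowerSeries k) : LaurentSeries k) := by
  rw [(detOneAdd_orderedProd φ hφ T hT N).2, Finset.prod_eq_single 1]
  · rw [htr, if_pos rfl]
  · intro i _ hi
    rw [htr, if_neg hi, zexp_zero i.succ_ne_zero, map_one]
  · intro h
    exact absurd (Finset.mem_range.2 (by omega)) h

/-- The determinant of `exp_z(f) exp_z(g) exp_z(-(f + g))` when `[f, g] ∈ E₀`. -/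
theorem hasDet_expProd_iff {f g : Module.End k V} (hf : f ∈ tateAlgebra Vp)
    (hg : g ∈ tateAlgebra Vp) (hfg : f * g - g * f ∈ tateIdealZero Vp) (d : LaurentSeries k) :
    HasDet Vp (expProd f g) d ↔
      d = ((zexp k 2 ((1 / 2 : k) * tateTrace (f * g - g * f)) : PowerSeries k) :
        LaurentSeries k) := by
  obtain ⟨t, h, ht⟩ := exists_isTraceIdeal Vp
  -- The traces are the same for every expansion: this gives uniqueness of the determinant, and its
  -- value for the expansion constructed below.
  have htr : ∀ φ : ℕ → Module.End k V, (∀ i, φ i ∈ tateIdealZero Vp) →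
      (∀ n : ℕ, ∀ᶠ N in Filter.atTop, PowerSeries.coeff n
        (orderedProd (fun i => zexp k (i + 1) (φ i)) N) = PowerSeries.coeff n (expProd f g)) →
      ∀ i, tateTrace (φ i) = if i = 1 then (1 / 2 : k) * tateTrace (f * g - g * f) else 0 := by
    intro φ hφ hconv i
    rw [← ht _ (hφ i), ← ht _ hfg]
    exact trace_of_expansion h hf hg hfg φ hφ hconv i
  constructor
  · rintro ⟨φ, T, hφ, hconv, hT, hdet⟩
    have hφ' : ∀ i, φ i ∈ tateIdealZero Vp := fun i => mem_tateIdealZero.2 (hφ i)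
    obtain ⟨N, ⟨-, hd⟩, hN⟩ := (hdet.and (Filter.eventually_ge_atTop 2)).exists
    rw [← hd]
    exact detOneAdd_orderedProd_of_tateTrace_eq hφ' (htr φ hφ' hconv) hT hN
  · rintro rfl
    obtain ⟨φ, hφ, hconv⟩ := exists_orderedProd_expansion h (expProd f g)
      (coeff_zero_expProd f g) fun n hn => coeff_expProd_mem h hf hg hfg hn
    have hconv' : ∀ n : ℕ, ∀ᶠ N in Filter.atTop, PowerSeries.coeff n
        (orderedProd (fun i => zexp k (i + 1) (φ i)) N) = PowerSeries.coeff n (expProd f g) :=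
      fun n => Filter.eventually_atTop.2 ⟨n, fun N hN => hconv N n hN⟩
    choose T hT using fun i => exists_isGivenBy_zexp i (isFinitePotent_of_mem (hφ i))
    refine ⟨φ, T, fun i => mem_tateIdealZero.1 (hφ i), hconv', hT,
      Filter.eventually_atTop.2 ⟨2, fun N hN => ⟨?_, ?_⟩⟩⟩
    · exact isFinitePotent_of_mem (detOneAdd_orderedProd φ hφ T hT N).1
    · exact detOneAdd_orderedProd_of_tateTrace_eq hφ (htr φ hφ hconv') hT hN

end Determinants

/-! ### The central extension of a normalised cocycle -/

section Extension

/-- The set underlying the extension of `K` by `N` defined by a 2-cocycle `c`. -/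
@[ext]
structure CocycleExtension {K : Type v} {N : Type u} (c : K → K → N) : Type (max u v) where
  /-- The component in `N`. -/
  left : N
  /-- The component in `K`. -/
  right : K

theorem exists_centralExtension {K : Type v} {N : Type u} [AddCommGroup K] [CommGroup N]
    (c : K → K → N) (hc : ∀ f g h, c f g * c (f + g) h = c g h * c f (g + h))
    (h0 : ∀ f, c 0 f = 1) (h0' : ∀ f, c f 0 = 1) :
    ∃ (G : Type (max u v)) (_ : Group G)
      (S : GroupExtension N G (Multiplicative K)) (s : K → G),
      S.inl.range ≤ Subgroup.center G ∧
      (∀ f : K, S.rightHom (s f) = Multiplicative.ofAdd f) ∧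
      ∀ f g : K, s f * s g = S.inl (c f g) * s (f + g) := by
  let _ : Mul (CocycleExtension c) :=
    ⟨fun x y => ⟨x.left * y.left * c x.right y.right, x.right + y.right⟩⟩
  let _ : One (CocycleExtension c) := ⟨⟨1, 0⟩⟩
  let _ : Inv (CocycleExtension c) :=
    ⟨fun x => ⟨x.left⁻¹ * (c (-x.right) x.right)⁻¹, -x.right⟩⟩
  have mul_def : ∀ x y : CocycleExtension c,
      x * y = ⟨x.left * y.left * c x.right y.right, x.right + y.right⟩ := fun _ _ => rfl
  let _ : Group (CocycleExtension c) := Group.ofLeftAxioms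
    -- Associativity is exactly the cocycle identity; the normalisation makes `(1, 0)` a unit.
    (fun x y z => by
      rw [mul_def, mul_def, mul_def, mul_def]
      refine CocycleExtension.ext ?_ (add_assoc _ _ _)
      calc x.left * y.left * c x.right y.right * z.left * c (x.right + y.right) z.right
          = x.left * y.left * z.left * (c x.right y.right * c (x.right + y.right) z.right) := by
            rw [mul_right_comm, mul_assoc, mul_assoc, mul_comm (c x.right y.right),
              mul_comm (c (x.right + y.right) z.right)]
            simp only [mul_comm, mul_left_comm]
        _ = _ := by
            rw [hc]
            simp only [mul_assoc, mul_left_comm])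
    (fun x => CocycleExtension.ext
      (show 1 * x.left * c 0 x.right = x.left by rw [h0, one_mul, mul_one]) (zero_add _))
    (fun x => CocycleExtension.ext
      (show x.left⁻¹ * (c (-x.right) x.right)⁻¹ * x.left * c (-x.right) x.right = 1 by
        rw [mul_right_comm _ _ x.left, inv_mul_cancel, one_mul, inv_mul_cancel])
      (neg_add_cancel _))
  let i : N →* CocycleExtension c :=
    { toFun := fun n => ⟨n, 0⟩
      map_one' := rfl
      map_mul' := fun a b => CocycleExtension.ext
        (show a * b = a * b * c 0 0 by rw [h0, mul_one]) (add_zero (0 : K)).symm }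
  let p : CocycleExtension c →* Multiplicative K :=
    { toFun := fun x => Multiplicative.ofAdd x.right
      map_one' := rfl
      map_mul' := fun x y => rfl }
  refine ⟨CocycleExtension c, inferInstance,
    ⟨i, p, fun a b h => congrArg CocycleExtension.left h, ?_, fun f => ⟨⟨1, f.toAdd⟩, rfl⟩⟩,
    fun f => ⟨1, f⟩, ?_, fun f => rfl, fun f g => ?_⟩
  · ext x
    constructor
    · rintro ⟨n, rfl⟩
      rfl
    · intro hx
      exact ⟨x.left, CocycleExtension.ext rfl (congrArg Multiplicative.toAdd hx).symm⟩
  · rintro _ ⟨n, rfl⟩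
    refine Subgroup.mem_center_iff.2 fun x => CocycleExtension.ext ?_ ?_
    · change x.left * n * c x.right 0 = n * x.left * c 0 x.right
      rw [h0, h0', mul_comm x.left]
    · change x.right + 0 = 0 + x.right
      rw [add_zero, zero_add]
  · refine CocycleExtension.ext ?_ (zero_add (f + g)).symm
    change 1 * 1 * c f g = c f g * 1 * c 0 (f + g)
    rw [h0, one_mul, one_mul, mul_one, mul_one]

end Extension

/-! ### The biadditive form behind the cocycle -/

section Symbol

variable {k V : Type*} [Field k] [AddCommGroup V] [Module k V] {Vp : Submodule k V}

/-- The trace of the commutator of `π f` and `π g`, with `π` a projection to `V₊`. -/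
def residueForm (Vp : Submodule k V) (f g : Module.End k V) : k :=
  tateTrace ((proj Vp * f) * (proj Vp * g) - (proj Vp * g) * (proj Vp * f))

theorem residueForm_add_left {f f' g : Module.End k V} (hf : f ∈ E Vp) (hf' : f' ∈ E Vp)
    (hg : g ∈ E Vp) (h : f * g = g * f) (h' : f' * g = g * f') :
    residueForm Vp (f + f') g = residueForm Vp f g + residueForm Vp f' g := by
  rw [residueForm, residueForm, residueForm, ← tateTrace_add
    (commutator_mem hf hg h (admissible_proj hf hg))
    (commutator_mem hf' hg h' (admissible_proj hf' hg))]
  congr 1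
  noncomm_ring

theorem residueForm_add_right {f g g' : Module.End k V} (hf : f ∈ E Vp) (hg : g ∈ E Vp)
    (hg' : g' ∈ E Vp) (h : f * g = g * f) (h' : f * g' = g' * f) :
    residueForm Vp f (g + g') = residueForm Vp f g + residueForm Vp f g' := by
  rw [residueForm, residueForm, residueForm, ← tateTrace_add
    (commutator_mem hf hg h (admissible_proj hf hg))
    (commutator_mem hf hg' h' (admissible_proj hf hg'))]
  congr 1
  noncomm_ring

variable [CharZero k]

/-- The unit `exp_{z²}(½ a)` of `k((z))`. -/
def halfExpUnit (a : k) : (LaurentSeries k)ˣ where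
  val := ((zexp k 2 ((1 / 2 : k) * a) : PowerSeries k) : LaurentSeries k)
  inv := ((zexp k 2 (-((1 / 2 : k) * a)) : PowerSeries k) : LaurentSeries k)
  val_inv := by rw [← map_mul, zexp_mul_zexp_neg two_ne_zero, map_one]
  inv_val := by rw [← map_mul, zexp_neg_mul_zexp two_ne_zero, map_one]

theorem halfExpUnit_add (a b : k) :
    halfExpUnit (a + b) = halfExpUnit a * halfExpUnit b := by
  ext1
  rw [Units.val_mul]
  change ((zexp k 2 ((1 / 2 : k) * (a + b)) : PowerSeries k) : LaurentSeries k) =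
    ((zexp k 2 ((1 / 2 : k) * a) : PowerSeries k) : LaurentSeries k) *
      ((zexp k 2 ((1 / 2 : k) * b) : PowerSeries k) : LaurentSeries k)
  rw [← map_mul, ← zexp_add two_ne_zero, mul_add]

end Symbol

end TateCocycle

end

/-! ### The main theorem -/

open TateCocycle in
theorem theoremt {k : Type u} {K : Type v} {V : Type w} [Field k] [CharZero k]
    [CommRing K] [Algebra k K] [AddCommGroup V] [Module k V] [Module K V] [IsScalarTower k K V]
    (Vp : Submodule k V)
    (hE : ∀ f : K, Algebra.lsmul k k V f ∈ E Vp) :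
    (∀ f g : K, ∃ f₁ g₁ : Module.End k V,
      Admissible Vp (Algebra.lsmul k k V f) (Algebra.lsmul k k V g) f₁ g₁) ∧
    ∃ c : K → K → (LaurentSeries k)ˣ,
      -- `c f g` is the determinant of the product, for every choice of `f₁`, `g₁`
      (∀ (f g : K) (f₁ g₁ : Module.End k V),
        Admissible Vp (Algebra.lsmul k k V f) (Algebra.lsmul k k V g) f₁ g₁ →
        ∀ d : LaurentSeries k, HasDet Vp (expProd f₁ g₁) d ↔ d = c f g) ∧
      -- `c` is a 2-cocycle (for the trivial action)
      (∀ f g h : K, c f g * c (f + g) h = c g h * c f (g + h)) ∧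
      -- the central extension with cocycle `c`
      (∃ (G : Type (max u v)) (_ : Group G)
        (S : GroupExtension (LaurentSeries k)ˣ G (Multiplicative K)) (s : K → G),
        S.inl.range ≤ Subgroup.center G ∧
        (∀ f : K, S.rightHom (s f) = Multiplicative.ofAdd f) ∧
        ∀ f g : K, s f * s g = S.inl (c f g) * s (f + g)) ∧
      -- the value of `c`
      (∀ (f g : K) (f₁ g₁ : Module.End k V),
        Admissible Vp (Algebra.lsmul k k V f) (Algebra.lsmul k k V g) f₁ g₁ →
        f₁ * g₁ - g₁ * f₁ ∈ E₀ Vp ∧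
        (c f g : LaurentSeries k) =
          ((zexp k 2 ((1 / 2 : k) * tateTrace (f₁ * g₁ - g₁ * f₁)) : PowerSeries k) :
            LaurentSeries k)) := by
  have hcomm : ∀ f g : K, Algebra.lsmul k k V f * Algebra.lsmul k k V g =
      Algebra.lsmul k k V g * Algebra.lsmul k k V f := fun f g => by
    rw [← map_mul, ← map_mul, mul_comm]
  let B : K → K → k := fun f g => residueForm Vp (Algebra.lsmul k k V f) (Algebra.lsmul k k V g)
  have hBl : ∀ f f' g, B (f + f') g = B f g + B f' g := fun f f' g => by
    change residueForm Vp _ _ = _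
    rw [map_add]
    exact residueForm_add_left (hE f) (hE f') (hE g) (hcomm f g) (hcomm f' g)
  have hBr : ∀ f g g', B f (g + g') = B f g + B f g' := fun f g g' => by
    change residueForm Vp _ _ = _
    rw [map_add]
    exact residueForm_add_right (hE f) (hE g) (hE g') (hcomm f g) (hcomm f g')
  have hzero : halfExpUnit (0 : k) = 1 := by
    have h := halfExpUnit_add (0 : k) 0
    rwa [add_zero, left_eq_mul] at h
  have hB0 : ∀ f, B 0 f = 0 := fun f => by
    have h := hBl 0 0 f
    rwa [add_zero, left_eq_add] at h
  have hB0' : ∀ f, B f 0 = 0 := fun f => by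
    have h := hBr f 0 0
    rwa [add_zero, left_eq_add] at h
  -- By biadditivity both exponents equal `B f g + B f h + B g h`.
  have hcocycle : ∀ f g h : K, halfExpUnit (B f g) * halfExpUnit (B (f + g) h) =
      halfExpUnit (B g h) * halfExpUnit (B f (g + h)) := fun f g h => by
    rw [← halfExpUnit_add, ← halfExpUnit_add, hBl, hBr]
    congr 1
    ring
  have hval : ∀ (f g : K) (f₁ g₁ : Module.End k V),
      Admissible Vp (Algebra.lsmul k k V f) (Algebra.lsmul k k V g) f₁ g₁ →
      (halfExpUnit (B f g) : LaurentSeries k) =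
        ((zexp k 2 ((1 / 2 : k) * tateTrace (f₁ * g₁ - g₁ * f₁)) : PowerSeries k) :
          LaurentSeries k) := fun f g f₁ g₁ h => by
    rw [tateTrace_commutator_eq (hE f) (hE g) (hcomm f g) h]
    rfl
  refine ⟨fun f g => ⟨_, _, admissible_proj (hE f) (hE g)⟩, fun f g => halfExpUnit (B f g),
    fun f g f₁ g₁ h d => ?_, hcocycle, ?_, fun f g f₁ g₁ h => ⟨?_, hval f g f₁ g₁ h⟩⟩
  · rw [hval f g f₁ g₁ h]
    exact hasDet_expProd_iff h.1 h.2.1 (commutator_mem (hE f) (hE g) (hcomm f g) h) d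
  · exact exists_centralExtension _ hcocycle (fun f => by rw [hB0, hzero])
      (fun f => by rw [hB0', hzero])
  · exact mem_tateIdealZero.1 (commutator_mem (hE f) (hE g) (hcomm f g) h)
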